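/- **Model.** Let $\Phi_v$ be a homogeneous Poisson point process in $\mathbb R^2$ of density $\lambda>0$ (the UAVs, all at altitude $h_v$), seen from its typical point $v_0$, which is put at the origin (Palm distribution). Every $v\in\Phi_v$ is the centre of a cluster of users at altitude $h_u$. The cluster sizes are i.i.d.; given the centres and the sizes, the users of the cluster at $v$ are at $u=v+y$ with independent displacements $y$, either of density $\frac1{2\pi\sigma^2}e^{-\|y\|^2/(2\sigma^2)}$ (Thomas, $\sigma>0$) or uniform in the disc of radius $R>0$ (Matérn). Put $\Delta h=|h_u-h_v|$ and $\gamma(r)=\lfloor r\sqrt{\beta_a\beta_b}\rfloor$ with $\beta_a,\beta_b>0$. Given its position $u$, the link from a user to $v_0$ is in line of sight (state $L$) with probability $p_L(\gamma(\|u\|))$, and otherwise not (state $N$, probability $p_N=1-p_L$), where for $\varepsilon>0$ $$p_L(\gamma)=\prod_{n=0}^{\gamma}\Big(1-\exp\Big(-\frac{(\gamma\max(h_u,h_v)-(n+\frac12)\Delta h)^2}{2\varepsilon^2\gamma^2}\Big)\Big)\quad(\gamma\ge1),\qquad p_L(0)=1 .$$ In state $\kappa\in\{L,N\}$ the channel gain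 is $H=C_\kappa\,(\|u\|^2+\Delta h^2)^{-\alpha_\kappa/2}\,G\,|\hat h|^2$, with $C_\kappa,\alpha_\kappa>0$, where $|\hat h|^2$ is Gamma distributed with shape $\mathcal N_\kappa>0$ and mean $1$, and $G$ takes the values $$(o_1,o_2,o_3,o_4)=(M_tM_r,\;m_tM_r,\;M_tm_r,\;m_tm_r)$$ with probabilities $$(p_1,p_2,p_3,p_4)=(ab,\;(1-a)b,\;a(1-b),\;(1-a)(1-b)),\qquad a=\tfrac{\theta^a_t}{2\pi}\tfrac{\theta^e_t}{\pi},\quad b=\tfrac{\theta^a_r}{2\pi}\tfrac{\theta^e_r}{\pi},$$ for gains $M_t,m_t,M_r,m_r\ge0$ and beamwidths $\theta^a_t,\theta^a_r\in[0,2\pi]$, $\theta^e_t,\theta^e_r\in[0,\pi]$. All these random choices are independent. Let $\mathbb U_v$ be the set of users of the cluster at $v$. The inter-cluster interference and its Laplace transform are $$I=\sum_{v\in\Phi_v\setminus v_0}\ \sum_{u\in\mathbb U_v}H_u\in[0,\infty],\qquad \mathcal L_e(s)=\mathbb E[e^{-sI}],\quad s\ge0.$$ **Statement.** For $g,q>0$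 let $$f(g|q)=\frac g{\sigma^2}\exp\Big(-\frac{g^2+q^2}{2\sigma^2}\Big)I_0\Big(\frac{gq}{\sigma^2}\Big)$$ in the Thomas case, with $I_0$ the modified Bessel function of the first kind of order zero, and $$f(g|q)=\frac{2g}{\pi R^2}\arccos\Big(\frac{g^2+q^2-R^2}{2gq}\Big)\mathbf 1_{\{|R-q|\le g\le R+q\}}+\frac{2g}{R^2}\mathbf 1_{\{g\le R-q\}}$$ in the Matérn case. For $\kappa\in\{L,N\}$ and $\gamma_1=\gamma(g)$ let $$\Lambda^\kappa(g,s)=p_\kappa(\gamma_1)\sum_{i=1}^4p_i\Big(1+\frac{s\,C_\kappa o_i}{\mathcal N_\kappa (g^2+\Delta h^2)^{\alpha_\kappa/2}}\Big)^{-\mathcal N_\kappa},$$ $$O_e(s,q)=\sum_{\gamma_1=0}^\infty\int_{\gamma_1/\sqrt{\beta_a\beta_b}}^{(\gamma_1+1)/\sqrt{\beta_a\beta_b}}\big(\Lambda^L(g,s)+\Lambda^N(g,s)\big)f(g|q)\,dg .$$ Then, for every $s\ge0$: 1. if every cluster has exactly $\bar N\in\mathbb N$ users, $$\mathcal L_e(s)=\exp\Big(-2\pi\lambda\int_0^\infty\big(1-O_e(s,q)^{\bar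 N}\big)\,q\,dq\Big);$$ 2. if the number of users in each cluster is Poisson distributed with mean $\bar n\ge0$, $$\mathcal L_e(s)=\exp\Big(-2\pi\lambda\int_0^\infty\big(1-e^{-\bar n(1-O_e(s,q))}\big)\,q\,dq\Big).$$ (If the integral is infinite, the right-hand side is $0$; likewise $e^{-sI}=0$ where $I=\infty$ and $s>0$, while for $s=0$ it is $1$.) -/

import Mathlib

open MeasureTheory ProbabilityTheory Set
open scoped ENNReal NNReal Nat

noncomputable section

/-- The horizontal plane with its Euclidean norm and Lebesgue measure. -/
abbrev Plane : Type := EuclideanSpace ℝ (Fin 2)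

/-- `exp (-x)` for `x ∈ [0, ∞]`, with `exp (-∞) = 0`. -/
def expNeg (x : ℝ≥0∞) : ℝ := if x = ∞ then 0 else Real.exp (-x.toReal)

/-! ### Point configurations, Poisson point configurations, Palm versions -/

section PointConfigurations

variable {Ω Ω₀ : Type*} [MeasurableSpace Ω] [MeasurableSpace Ω₀]

/-- The counting measure `∑ₙ δ_{Xₙ}` of the random points `X 0, X 1, …`. -/
def config (X : ℕ → Ω → Plane) (ω : Ω) : Measure Plane :=
  Measure.sum fun n => Measure.dirac (X n ω)

/-- The random points `X 0, X 1, …` (in any order) form a homogeneous Poisson point configuration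
of density `lam` in the plane: the number of points in a Borel set of finite area is Poisson with
mean `lam * area`, and the numbers of points in disjoint Borel sets are independent.
(For `lam > 0` there are infinitely many points, so an enumeration by `ℕ` loses nothing.) -/
structure IsHomogeneousPPP (lam : ℝ) (X : ℕ → Ω → Plane) (P : Measure Ω) : Prop where
  measurable : ∀ n, Measurable (X n)
  count_law : ∀ A : Set Plane, MeasurableSet A → volume A ≠ ∞ →
    HasLaw (fun ω => config X ω A)
      ((poissonMeasure (lam * (volume A).toReal).toNNReal).map (fun k : ℕ => (k : ℝ≥0∞))) P
  count_indep : ∀ (k : ℕ) (A : Fin k → Set Plane), (∀ i, MeasurableSet (A i)) →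
    Pairwise (fun i j => Disjoint (A i) (A j)) →
    iIndepFun (fun i ω => config X ω (A i)) P

/-- `X` (under `P`) is the configuration `Φ` (under `P₀`, stationary of density `lam`) seen from
its typical point, which is put at the origin and listed first: `X 0 = 0`, and the law of the
configuration of `X` is the Palm distribution of `Φ`, that is
`E₀ #{x ∈ Φ ∩ B : Φ - x ∈ 𝒜} = lam * area B * P(X ∈ 𝒜)`
for every Borel set `B` and every measurable set `𝒜` of configurations. -/
structure IsPalmVersion (lam : ℝ) (Φ : ℕ → Ω₀ → Plane) (P₀ : Measure Ω₀)
    (X : ℕ → Ω → Plane) (P : Measure Ω) : Prop where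
  measurable : ∀ n, Measurable (X n)
  typical_at_origin : ∀ᵐ ω ∂P, X 0 ω = 0
  palm : ∀ (B : Set Plane) (𝒜 : Set (Measure Plane)), MeasurableSet B → MeasurableSet 𝒜 →
    ∫⁻ ω, ∑' n, {ω' | Φ n ω' ∈ B ∧ config (fun m ω'' => Φ m ω'' - Φ n ω'') ω' ∈ 𝒜}.indicator
        (fun _ => (1 : ℝ≥0∞)) ω ∂P₀
      = ENNReal.ofReal lam * volume B * P {ω | config X ω ∈ 𝒜}

end PointConfigurations

/-! ### Cluster shapes: Thomas and Matérn -/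

/-- The unit step function. -/
def unitStep (x : ℝ) : ℝ := if 0 ≤ x then 1 else 0

/-- The two cluster shapes: Thomas with standard deviation `σ`, Matérn with radius `R`. -/
inductive ClusterShape where
  | thomas (σ : ℝ)
  | matern (R : ℝ)

namespace ClusterShape

/-- The scale parameter (standard deviation, respectively radius). -/
def scale : ClusterShape → ℝ
  | thomas σ => σ
  | matern R => R

/-- The density in the plane of the position of a user at `u` in a cluster centred at `v`. -/
def density (c : ClusterShape) (u v : Plane) : ℝ :=
  match c with
  | thomas σ => 1 / (2 * Real.pi * σ ^ 2) * Real.exp (-(‖u - v‖ ^ 2 / (2 * σ ^ 2)))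
  | matern R => 1 / (Real.pi * R ^ 2) * unitStep (R - ‖u - v‖)

/-- The law of the displacement `u - v` of a user from its cluster centre. -/
def offsetLaw (c : ClusterShape) : Measure Plane :=
  volume.withDensity fun y => ENNReal.ofReal (c.density y 0)

end ClusterShape

/-- The modified Bessel function of the first kind of order zero. -/
def besselI0 (x : ℝ) : ℝ := ∑' k : ℕ, (x / 2) ^ (2 * k) / ((k ! : ℝ)) ^ 2

/-- The density, at `g`, of the distance from the origin of a user whose cluster centre is at
distance `q` from the origin. -/
def ClusterShape.distDensity (c : ClusterShape) (g q : ℝ) : ℝ :=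
  match c with
  | .thomas σ =>
      g / σ ^ 2 * Real.exp (-((g ^ 2 + q ^ 2) / (2 * σ ^ 2))) * besselI0 (g * q / σ ^ 2)
  | .matern R =>
      2 * g / (Real.pi * R ^ 2) * Real.arccos ((g ^ 2 + q ^ 2 - R ^ 2) / (2 * g * q))
          * unitStep (g - |R - q|) * unitStep (R + q - g)
        + 2 * g / R ^ 2 * unitStep (R - q - g)

/-! ### Channel: blockage, path loss, antenna gain, fading -/

/-- Line-of-sight and non-line-of-sight links. -/
inductive LinkState where
  | los
  | nlos

/-- The deterministic parameters of the uplink. -/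
structure UplinkParams where
  /-- density of the cluster centres (UAVs) -/
  lam : ℝ
  /-- shape of the clusters -/
  shape : ClusterShape
  /-- altitude of the users -/
  hu : ℝ
  /-- altitude of the UAVs -/
  hv : ℝ
  /-- ratio of the obstacle area to the total area -/
  βa : ℝ
  /-- density of the obstacles -/
  βb : ℝ
  /-- scale of the Rayleigh distributed obstacle heights -/
  ε : ℝ
  /-- path loss intercepts -/
  C : LinkState → ℝ
  /-- path loss exponents -/
  α : LinkState → ℝ
  /-- Nakagami fading parameters -/
  nak : LinkState → ℝ
  /-- azimuth and elevation beamwidths of the transmitter (user) -/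
  θta : ℝ
  θte : ℝ
  /-- azimuth and elevation beamwidths of the receiver (UAV) -/
  θra : ℝ
  θre : ℝ
  /-- main lobe and side lobe gains of the transmitter (user) -/
  Mt : ℝ
  mt : ℝ
  /-- main lobe and side lobe gains of the receiver (UAV) -/
  Mr : ℝ
  mr : ℝ

namespace UplinkParams

/-- The physical ranges of the parameters. -/
structure Admissible (p : UplinkParams) : Prop where
  lam_pos : 0 < p.lam
  scale_pos : 0 < p.shape.scale
  βa_pos : 0 < p.βa
  βb_pos : 0 < p.βb
  ε_pos : 0 < p.ε
  C_pos : ∀ κ, 0 < p.C κ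
  α_pos : ∀ κ, 0 < p.α κ
  nak_pos : ∀ κ, 0 < p.nak κ
  θta_mem : p.θta ∈ Icc 0 (2 * Real.pi)
  θte_mem : p.θte ∈ Icc 0 Real.pi
  θra_mem : p.θra ∈ Icc 0 (2 * Real.pi)
  θre_mem : p.θre ∈ Icc 0 Real.pi
  Mt_nonneg : 0 ≤ p.Mt
  mt_nonneg : 0 ≤ p.mt
  Mr_nonneg : 0 ≤ p.Mr
  mr_nonneg : 0 ≤ p.mr

variable (p : UplinkParams)

/-- `Δh`, the difference of the altitudes. -/
def Δh : ℝ := |p.hu - p.hv|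

/-- `√(βa βb)`. -/
def rootβ : ℝ := Real.sqrt (p.βa * p.βb)

/-- `γ(r) = ⌊r √(βa βb)⌋`. -/
def γ (r : ℝ) : ℕ := ⌊r * p.rootβ⌋₊

/-- The probability of a line-of-sight link as a function of `γ`. For `γ = 0` the quotient in the
exponent has denominator zero and is read as `+∞`, so that the link is in line of sight. -/
def probLos (γ : ℕ) : ℝ :=
  if γ = 0 then 1 else
    ∏ n ∈ Finset.range (γ + 1),
      (1 - Real.exp (-(((γ : ℝ) * max p.hu p.hv - ((n : ℝ) + 1 / 2) * p.Δh) ^ 2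
        / (2 * p.ε ^ 2 * (γ : ℝ) ^ 2))))

/-- The probability of a link in state `κ`. -/
def prob (κ : LinkState) (γ : ℕ) : ℝ :=
  match κ with
  | .los => p.probLos γ
  | .nlos => 1 - p.probLos γ

/-- The path loss of a link in state `κ` at horizontal distance `r`. -/
def pathLoss (κ : LinkState) (r : ℝ) : ℝ :=
  p.C κ / Real.sqrt ((r ^ 2 + p.Δh ^ 2) ^ p.α κ)

/-- The four possible values of the directivity gain. -/
def gainValue : Fin 4 → ℝ :=
  ![p.Mt * p.Mr, p.mt * p.Mr, p.Mt * p.mr, p.mt * p.mr]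

/-- The probabilities of the four values of the directivity gain. -/
def gainProb : Fin 4 → ℝ :=
  let a := p.θta / (2 * Real.pi) * (p.θte / Real.pi)
  let b := p.θra / (2 * Real.pi) * (p.θre / Real.pi)
  ![a * b, (1 - a) * b, a * (1 - b), (1 - a) * (1 - b)]

/-- The law of the directivity gain of an interferer. -/
def gainLaw : Measure ℝ :=
  ∑ i : Fin 4, ENNReal.ofReal (p.gainProb i) • Measure.dirac (p.gainValue i)

/-- The joint law of everything attached to one user: displacement from the cluster centre,
uniform variable deciding about blockage, normalized Gamma power fading of a line-of-sight link and
of a non-line-of-sight link, directivity gain; all independent. -/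
def userLaw : Measure (Plane × ℝ × ℝ × ℝ × ℝ) :=
  p.shape.offsetLaw.prod ((volume.restrict (Icc (0 : ℝ) 1)).prod
    ((gammaMeasure (p.nak .los) (p.nak .los)).prod
      ((gammaMeasure (p.nak .nlos) (p.nak .nlos)).prod p.gainLaw)))

/-- `Λ^κ(g, s)`, where `γ` is the value of `⌊g √(βa βb)⌋`. -/
def Λ (κ : LinkState) (γ : ℕ) (g s : ℝ) : ℝ :=
  p.prob κ γ * ∑ i : Fin 4, p.gainProb i *
    (1 + s * p.C κ * p.gainValue i
      / (p.nak κ * Real.sqrt ((g ^ 2 + p.Δh ^ 2) ^ p.α κ))) ^ (-p.nak κ)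

/-- `O_e(s, q)`. -/
def Oe (s q : ℝ) : ℝ :=
  ∑' γ₁ : ℕ, ∫ g in ((γ₁ : ℝ) / p.rootβ)..(((γ₁ : ℝ) + 1) / p.rootβ),
    (p.Λ .los γ₁ g s + p.Λ .nlos γ₁ g s) * p.shape.distDensity g q

end UplinkParams

/-! ### The uplink network -/

/-- An uplink network on `(Ω, P)` with parameters `p`, seen from the UAV `v₀` at the origin.
`Φ` (on `(Ω₀, P₀)`) is the point configuration of all UAVs, `parent 0 = v₀, parent 1, …` are the
UAVs seen from the typical one, `size n` is the number of users in the cluster of `parent n`, with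
law `sizeLaw`, and the other variables belong to the `k`-th user of the cluster of `parent n`
(used for `k < size n`). -/
structure UplinkNetwork (p : UplinkParams) {Ω₀ Ω : Type*} [MeasurableSpace Ω₀] [MeasurableSpace Ω]
    (Φ : ℕ → Ω₀ → Plane) (P₀ : Measure Ω₀) (sizeLaw : Measure ℕ) (P : Measure Ω) where
  parent : ℕ → Ω → Plane
  size : ℕ → Ω → ℕ
  /-- displacement of a user from its cluster centre -/
  offset : ℕ → ℕ → Ω → Plane
  /-- uniform variable on `[0, 1]` that decides whether the link is blocked -/
  block : ℕ → ℕ → Ω → ℝ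
  /-- small scale power fading `|ĥ|²` of a line-of-sight link -/
  fadeLos : ℕ → ℕ → Ω → ℝ
  /-- small scale power fading `|ĥ|²` of a non-line-of-sight link -/
  fadeNlos : ℕ → ℕ → Ω → ℝ
  /-- directivity gain -/
  gain : ℕ → ℕ → Ω → ℝ
  palm : IsPalmVersion p.lam Φ P₀ parent P
  measurable_size : ∀ n, Measurable (size n)
  measurable_offset : ∀ n k, Measurable (offset n k)
  measurable_block : ∀ n k, Measurable (block n k)
  measurable_fadeLos : ∀ n k, Measurable (fadeLos n k)
  measurable_fadeNlos : ∀ n k, Measurable (fadeNlos n k)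
  measurable_gain : ∀ n k, Measurable (gain n k)
  size_law : ∀ n, HasLaw (size n) sizeLaw P
  user_law : ∀ n k, HasLaw
    (fun ω => (offset n k ω, block n k ω, fadeLos n k ω, fadeNlos n k ω, gain n k ω)) p.userLaw P
  size_indep : iIndepFun size P
  user_indep : iIndepFun (fun (i : ℕ × ℕ) ω =>
    (offset i.1 i.2 ω, block i.1 i.2 ω, fadeLos i.1 i.2 ω, fadeNlos i.1 i.2 ω, gain i.1 i.2 ω)) P
  /-- cluster sizes and users are independent -/
  size_user_indep : IndepFun (fun ω n => size n ω) (fun ω (i : ℕ × ℕ) =>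
    (offset i.1 i.2 ω, block i.1 i.2 ω, fadeLos i.1 i.2 ω, fadeNlos i.1 i.2 ω, gain i.1 i.2 ω)) P
  /-- cluster centres are independent of cluster sizes and users -/
  parent_indep : IndepFun (fun ω n => parent n ω) (fun ω => (fun n => size n ω,
    fun i : ℕ × ℕ => (offset i.1 i.2 ω, block i.1 i.2 ω, fadeLos i.1 i.2 ω,
      fadeNlos i.1 i.2 ω, gain i.1 i.2 ω))) P

namespace UplinkNetwork

variable {p : UplinkParams} {Ω₀ Ω : Type*} [MeasurableSpace Ω₀] [MeasurableSpace Ω]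
  {Φ : ℕ → Ω₀ → Plane} {P₀ : Measure Ω₀} {sizeLaw : Measure ℕ} {P : Measure Ω}
  (N : UplinkNetwork p Φ P₀ sizeLaw P)

/-- The position of the `k`-th user in the cluster of the `n`-th UAV. -/
def user (n k : ℕ) (ω : Ω) : Plane := N.parent n ω + N.offset n k ω

/-- The channel gain `H_g` from that user to the UAV at the origin: path loss times directivity
gain times power fading, where the link is in line of sight with probability
`p_L(γ(‖u‖))` given the position `u`, and not in line of sight otherwise. -/
def channelGain (n k : ℕ) (ω : Ω) : ℝ :=
  if N.block n k ω < p.prob .los (p.γ ‖N.user n k ω‖) then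
    p.pathLoss .los ‖N.user n k ω‖ * N.gain n k ω * N.fadeLos n k ω
  else
    p.pathLoss .nlos ‖N.user n k ω‖ * N.gain n k ω * N.fadeNlos n k ω

/-- The inter-cluster interference: the sum over all users of all clusters except that of `v₀`. -/
def interInterference (ω : Ω) : ℝ≥0∞ :=
  ∑' n : {n : ℕ // n ≠ 0}, ∑ k ∈ Finset.range (N.size n ω), ENNReal.ofReal (N.channelGain n k ω)

/-- The Laplace transform `E[exp(-s I_inter)]` of the inter-cluster interference. -/
def laplaceInter (s : ℝ) : ℝ :=
  ∫ ω, expNeg (ENNReal.ofReal s * N.interInterference ω) ∂P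

end UplinkNetwork

end

open Filter Topology

/-!
The Laplace functional of a Poisson configuration is computed on simple functions from the
independence of the counts, and differentiating it in the direction of an indicator gives the
reduced Campbell formula. Inserted into the Palm formula over a ball that shrinks to the origin, on
which a continuous test function hardly changes under translation, it shows that the configuration
seen from the typical point, with that point removed, is again Poisson (Slivnyak). Given the centres
and the sizes, the users are independent, so that a cluster centred at `x` contributes the
probability generating function of its size at the Laplace transform of one user. Averaging over
blockage, fading and antenna gain turns the latter into the mean of `Λ^L + Λ^N` at the distance of
the user from the origin; the offset law in polar coordinates produces the density `f(g|q)`, by the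
integral representation of `I₀` in the Thomas case and by the law of cosines in the Matérn case.
-/

/-- `exp (-x)` as a map of `[0, ∞]` to itself: the `[0, ∞]`-valued form of `expNeg`, used so that
Laplace functionals can be computed with Lebesgue integrals. -/
noncomputable def eexpNeg (x : ℝ≥0∞) : ℝ≥0∞ := EReal.exp (-(x : EReal))

lemma eexpNeg_zero : eexpNeg 0 = 1 := by simp [eexpNeg]

lemma eexpNeg_top : eexpNeg ∞ = 0 := by simp [eexpNeg]

lemma eexpNeg_ofReal {x : ℝ} (hx : 0 ≤ x) :
    eexpNeg (ENNReal.ofReal x) = ENNReal.ofReal (Real.exp (-x)) := by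
  rw [eexpNeg, EReal.coe_ennreal_ofReal, max_eq_left hx, ← EReal.coe_neg, EReal.exp_coe]

lemma expNeg_nonneg (x : ℝ≥0∞) : 0 ≤ expNeg x := by
  unfold expNeg; split_ifs <;> positivity

lemma eexpNeg_eq_ofReal_expNeg (x : ℝ≥0∞) : eexpNeg x = ENNReal.ofReal (expNeg x) := by
  by_cases hx : x = ∞
  · simp [hx, eexpNeg_top, expNeg]
  · rw [expNeg, if_neg hx, ← eexpNeg_ofReal ENNReal.toReal_nonneg, ENNReal.ofReal_toReal hx]

lemma toReal_eexpNeg (x : ℝ≥0∞) : (eexpNeg x).toReal = expNeg x := by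
  rw [eexpNeg_eq_ofReal_expNeg, ENNReal.toReal_ofReal (expNeg_nonneg x)]

lemma eexpNeg_add (x y : ℝ≥0∞) : eexpNeg (x + y) = eexpNeg x * eexpNeg y := by
  rw [eexpNeg, EReal.coe_ennreal_add, EReal.neg_add (.inl (EReal.coe_ennreal_ne_bot x))
    (.inr (EReal.coe_ennreal_ne_bot y)), sub_eq_add_neg, EReal.exp_add]
  rfl

lemma eexpNeg_sum {ι : Type*} (s : Finset ι) (f : ι → ℝ≥0∞) :
    eexpNeg (∑ i ∈ s, f i) = ∏ i ∈ s, eexpNeg (f i) := by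
  classical
  induction s using Finset.induction_on with
  | empty => simp [eexpNeg_zero]
  | insert a s ha ih => rw [Finset.sum_insert ha, Finset.prod_insert ha, eexpNeg_add, ih]

lemma eexpNeg_natCast_mul (k : ℕ) (x : ℝ≥0∞) : eexpNeg (k * x) = eexpNeg x ^ k := by
  simpa using eexpNeg_sum (Finset.range k) fun _ => x

lemma antitone_eexpNeg : Antitone eexpNeg := fun _ _ h =>
  EReal.exp_monotone (EReal.neg_le_neg_iff.2 (EReal.coe_ennreal_le_coe_ennreal_iff.2 h))

lemma eexpNeg_le_one (x : ℝ≥0∞) : eexpNeg x ≤ 1 := eexpNeg_zero ▸ antitone_eexpNeg zero_le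

lemma eexpNeg_ne_top (x : ℝ≥0∞) : eexpNeg x ≠ ∞ :=
  ((eexpNeg_le_one x).trans_lt ENNReal.one_lt_top).ne

lemma eexpNeg_ne_zero {x : ℝ≥0∞} (hx : x ≠ ∞) : eexpNeg x ≠ 0 := by
  simpa [eexpNeg] using hx

lemma continuous_eexpNeg : Continuous eexpNeg :=
  ENNReal.continuous_exp.comp (continuous_neg.comp continuous_coe_ennreal_ereal)

@[fun_prop]
lemma measurable_eexpNeg : Measurable eexpNeg := continuous_eexpNeg.measurable

lemma one_sub_eexpNeg_le (x : ℝ≥0∞) : 1 - eexpNeg x ≤ x := by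
  by_cases hx : x = ∞
  · simp [hx]
  · rw [← ENNReal.ofReal_toReal hx, eexpNeg_ofReal ENNReal.toReal_nonneg, ← ENNReal.ofReal_one,
      ← ENNReal.ofReal_sub _ (Real.exp_nonneg _)]
    exact ENNReal.ofReal_le_ofReal (by linarith [Real.add_one_le_exp (-x.toReal)])

lemma mul_eexpNeg_le (x : ℝ≥0∞) : x * eexpNeg x ≤ 1 - eexpNeg x := by
  by_cases hx : x = ∞
  · simp [hx, eexpNeg_top]
  · rw [← ENNReal.ofReal_toReal hx, eexpNeg_ofReal ENNReal.toReal_nonneg, ← ENNReal.ofReal_one,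
      ← ENNReal.ofReal_sub _ (Real.exp_nonneg _), ← ENNReal.ofReal_mul ENNReal.toReal_nonneg]
    have h := mul_le_mul_of_nonneg_right (Real.add_one_le_exp x.toReal)
      (Real.exp_nonneg (-x.toReal))
    rw [← Real.exp_add, add_neg_cancel, Real.exp_zero] at h
    exact ENNReal.ofReal_le_ofReal (by linarith)

lemma one_sub_eexpNeg_mul_eexpNeg (a b : ℝ≥0∞) :
    (1 - eexpNeg b) * eexpNeg a = eexpNeg a - eexpNeg (a + b) := by
  rw [ENNReal.sub_mul fun _ _ => eexpNeg_ne_top a, one_mul, eexpNeg_add, mul_comm]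

lemma one_sub_eexpNeg_add (a b : ℝ≥0∞) :
    1 - eexpNeg (a + b) = (1 - eexpNeg a) + (1 - eexpNeg b) * eexpNeg a := by
  rw [one_sub_eexpNeg_mul_eexpNeg, tsub_add_tsub_cancel (eexpNeg_le_one a)
    (antitone_eexpNeg le_self_add)]

lemma one_sub_eexpNeg_add_le (a b : ℝ≥0∞) : 1 - eexpNeg (a + b) ≤ (1 - eexpNeg a) + b := by
  rw [one_sub_eexpNeg_add]
  gcongr
  exact (mul_le_of_le_one_right' (eexpNeg_le_one a)).trans (one_sub_eexpNeg_le b)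

lemma tendsto_natCast_mul_one_sub_eexpNeg {x : ℕ → ℝ≥0∞} {y : ℝ≥0∞} (hy : y ≠ ∞)
    (h : Tendsto (fun n : ℕ => (n : ℝ≥0∞) * x n) atTop (𝓝 y)) :
    Tendsto (fun n : ℕ => (n : ℝ≥0∞) * (1 - eexpNeg (x n))) atTop (𝓝 y) := by
  have hx : Tendsto x atTop (𝓝 0) := by
    have h' := ENNReal.Tendsto.mul h (Or.inr (by simp)) ENNReal.tendsto_inv_nat_nhds_zero
      (Or.inr hy)
    rw [mul_zero] at h'
    refine h'.congr' ?_
    filter_upwards [eventually_ne_atTop 0] with n hn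
    rw [mul_right_comm, ENNReal.mul_inv_cancel (by exact_mod_cast hn) (ENNReal.natCast_ne_top n),
      one_mul]
  have hexp : Tendsto (fun n => eexpNeg (x n)) atTop (𝓝 1) :=
    eexpNeg_zero ▸ (continuous_eexpNeg.tendsto 0).comp hx
  have hlower := ENNReal.Tendsto.mul h (Or.inr ENNReal.one_ne_top) hexp (Or.inl one_ne_zero)
  rw [mul_one] at hlower
  refine tendsto_of_tendsto_of_tendsto_of_le_of_le hlower h (fun n => ?_) (fun n => ?_)
  · simpa only [mul_assoc] using mul_le_mul_right (mul_eexpNeg_le (x n)) (n : ℝ≥0∞)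
  · exact mul_le_mul_right (one_sub_eexpNeg_le (x n)) (n : ℝ≥0∞)

lemma tendsto_natCast_mul_one_sub_eexpNeg_inv_mul {y : ℝ≥0∞} (hy : y ≠ ∞) :
    Tendsto (fun n : ℕ => (n : ℝ≥0∞) * (1 - eexpNeg ((n : ℝ≥0∞)⁻¹ * y))) atTop (𝓝 y) := by
  refine tendsto_natCast_mul_one_sub_eexpNeg hy (tendsto_const_nhds.congr' ?_)
  filter_upwards [eventually_ne_atTop 0] with n hn
  rw [← mul_assoc, ENNReal.mul_inv_cancel (by exact_mod_cast hn) (ENNReal.natCast_ne_top n),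
    one_mul]

lemma le_of_forall_mul_eexpNeg_le {a b c : ℝ≥0∞} (ha : a ≠ ∞) (hc : c ≠ ∞)
    (h : ∀ η : ℝ≥0, 0 < η → a * eexpNeg (c * η) ≤ b) : a ≤ b := by
  have htendsto : Tendsto (fun η : ℝ≥0 => a * eexpNeg (c * η)) (𝓝[>] 0) (𝓝 a) := by
    have hcont : Continuous fun η : ℝ≥0 => a * eexpNeg (c * η) :=
      (ENNReal.continuous_const_mul ha).comp
        (continuous_eexpNeg.comp ((ENNReal.continuous_const_mul hc).comp ENNReal.continuous_coe))
    simpa [eexpNeg_zero] using (hcont.tendsto 0).mono_left nhdsWithin_le_nhds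
  exact le_of_tendsto htendsto (eventually_mem_nhdsWithin.mono h)

/-- The probability generating function of a law on `ℕ`. -/
noncomputable def pgf (μ : Measure ℕ) (z : ℝ) : ℝ := ∫ k, z ^ k ∂μ

lemma pgf_dirac (n : ℕ) (z : ℝ) : pgf (Measure.dirac n) z = z ^ n := integral_dirac _ n

lemma pgf_poissonMeasure (m : ℝ≥0) (z : ℝ) :
    pgf (poissonMeasure m) z = Real.exp (-(m * (1 - z))) := by
  have hexp : HasSum (fun k : ℕ => Real.exp (-m) * ((m * z) ^ k / k !))
      (Real.exp (-m) * Real.exp (m * z)) := by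
    rw [Real.exp_eq_exp_ℝ]
    exact (NormedSpace.expSeries_div_hasSum_exp ((m : ℝ) * z)).mul_left _
  rw [pgf, integral_poissonMeasure, show -(m * (1 - z)) = -(m : ℝ) + m * z by ring, Real.exp_add,
    ← hexp.tsum_eq]
  exact tsum_congr fun k => by rw [smul_eq_mul, mul_pow]; ring

section PGF

variable (μ : Measure ℕ) {z : ℝ}

lemma integrable_pow_of_mem_Icc [IsFiniteMeasure μ] (hz : z ∈ Icc (0 : ℝ) 1) :
    Integrable (fun k : ℕ => z ^ k) μ :=
  .of_bound measurable_from_nat.aestronglyMeasurable 1 <| .of_forall fun k => by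
    simpa [abs_of_nonneg hz.1] using pow_le_one₀ hz.1 hz.2

lemma ofReal_pgf [IsFiniteMeasure μ] (hz : z ∈ Icc (0 : ℝ) 1) :
    ENNReal.ofReal (pgf μ z) = ∫⁻ k, ENNReal.ofReal z ^ k ∂μ := by
  rw [pgf, ofReal_integral_eq_lintegral_ofReal (integrable_pow_of_mem_Icc μ hz)
    (.of_forall fun k => pow_nonneg hz.1 k)]
  simp_rw [ENNReal.ofReal_pow hz.1]

lemma pgf_pos [IsProbabilityMeasure μ] (hz : z ∈ Ioc (0 : ℝ) 1) : 0 < pgf μ z := by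
  refine (integral_pos_iff_support_of_nonneg (fun k => pow_nonneg hz.1.le k)
    (integrable_pow_of_mem_Icc μ ⟨hz.1.le, hz.2⟩)).2 ?_
  rw [show (Function.support fun k : ℕ => z ^ k) = univ from
    Function.support_eq_univ fun k => (pow_pos hz.1 k).ne']
  simp

lemma pgf_le_one [IsProbabilityMeasure μ] (hz : z ∈ Icc (0 : ℝ) 1) : pgf μ z ≤ 1 := by
  simpa [pgf] using integral_mono (integrable_pow_of_mem_Icc μ hz) (integrable_const (1 : ℝ))
    fun k => pow_le_one₀ hz.1 hz.2

lemma continuousOn_pgf [IsFiniteMeasure μ] : ContinuousOn (pgf μ) (Icc 0 1) :=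
  continuousOn_of_dominated (bound := fun _ => 1)
    (fun _ _ => measurable_from_nat.aestronglyMeasurable)
    (fun z hz => .of_forall fun k => by
      simpa [abs_of_nonneg hz.1] using pow_le_one₀ hz.1 hz.2)
    (integrable_const 1) (.of_forall fun k => (continuous_pow k).continuousOn)

end PGF

lemma lintegral_eexpNeg_mul_poissonMeasure (m : ℝ≥0) (c : ℝ≥0∞) :
    ∫⁻ k, eexpNeg (c * k) ∂poissonMeasure m = eexpNeg (m * (1 - eexpNeg c)) := by
  have hle : expNeg c ≤ 1 := by
    simpa [toReal_eexpNeg] using ENNReal.toReal_mono ENNReal.one_ne_top (eexpNeg_le_one c)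
  simp_rw [mul_comm c, eexpNeg_natCast_mul, eexpNeg_eq_ofReal_expNeg c]
  rw [← ofReal_pgf _ ⟨expNeg_nonneg c, hle⟩, pgf_poissonMeasure, ← ENNReal.ofReal_one,
    ← ENNReal.ofReal_sub _ (expNeg_nonneg c), ← ENNReal.ofReal_coe_nnreal,
    ← ENNReal.ofReal_mul m.coe_nonneg,
    eexpNeg_ofReal (mul_nonneg m.coe_nonneg (sub_nonneg.2 hle))]

lemma lintegral_natCast_poissonMeasure (m : ℝ≥0) :
    ∫⁻ k, (k : ℝ≥0∞) ∂poissonMeasure m = m := by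
  have hweight (f : ℕ → ℝ≥0∞) : ∫⁻ k, f k ∂poissonMeasure m =
      ∑' k, ENNReal.ofReal (Real.exp (-m) * m ^ k / k !) * f k := by
    simp [poissonMeasure, lintegral_sum_measure]
  have hshift (k : ℕ) : ENNReal.ofReal (Real.exp (-m) * m ^ (k + 1) / (k + 1)!) * (k + 1 : ℕ) =
      m * (ENNReal.ofReal (Real.exp (-m) * m ^ k / k !) * 1) := by
    rw [← ENNReal.ofReal_natCast, ← ENNReal.ofReal_mul (by positivity), mul_one,
      ← ENNReal.ofReal_coe_nnreal, ← ENNReal.ofReal_mul m.coe_nonneg, Nat.factorial_succ]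
    congr 1
    push_cast
    field_simp
    rw [pow_succ']
  rw [hweight, tsum_eq_zero_add' ENNReal.summable, Nat.cast_zero, mul_zero, zero_add]
  simp_rw [hshift]
  rw [ENNReal.tsum_mul_left, ← hweight fun _ => 1, lintegral_one, measure_univ, mul_one]

lemma exists_monotone_simpleFunc_tendsto {α : Type*} [MeasurableSpace α] (μ : Measure α)
    [SigmaFinite μ] {ψ : α → ℝ≥0∞} (hψ : Measurable ψ) :
    ∃ f : ℕ → SimpleFunc α ℝ≥0∞, Monotone f ∧ (∀ n c, c ≠ 0 → μ (f n ⁻¹' {c}) ≠ ∞) ∧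
      ∀ y, Tendsto (fun n => f n y) atTop (𝓝 (ψ y)) := by
  have hS (n : ℕ) : MeasurableSet (spanningSets μ n) := measurableSet_spanningSets μ n
  refine ⟨fun n => (SimpleFunc.eapprox ψ n).restrict (spanningSets μ n), fun m n hmn y => ?_,
    fun n c hc => ?_, fun y => ?_⟩
  · simp only [SimpleFunc.restrict_apply _ (hS _)]
    exact (indicator_le_indicator (SimpleFunc.monotone_eapprox ψ hmn y)).trans
      (indicator_le_indicator_of_subset (monotone_spanningSets μ hmn) (fun _ => zero_le) y)
  · refine measure_ne_top_of_subset (fun y hy => ?_) (measure_spanningSets_lt_top μ n).ne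
    by_contra hy'
    rw [mem_preimage, SimpleFunc.restrict_apply _ (hS n), indicator_of_notMem hy'] at hy
    exact hc hy.symm
  · have hlim := tendsto_atTop_iSup fun m n hmn => SimpleFunc.monotone_eapprox ψ hmn y
    rw [SimpleFunc.iSup_eapprox_apply hψ] at hlim
    refine hlim.congr' ?_
    filter_upwards [eventually_ge_atTop (spanningSetsIndex μ y)] with n hn
    rw [SimpleFunc.restrict_apply _ (hS n),
      indicator_of_mem (mem_spanningSets_of_index_le μ y hn)]

/-! ### Laplace functionals of Poisson configurations -/

section Config

variable {Ω : Type*} {X : ℕ → Ω → Plane} {ψ : Plane → ℝ≥0∞}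

lemma lintegral_config (hψ : Measurable ψ) (ω : Ω) :
    ∫⁻ y, ψ y ∂config X ω = ∑' n, ψ (X n ω) := by
  simp [config, lintegral_sum_measure, lintegral_dirac' _ hψ]

variable [MeasurableSpace Ω]

lemma measurable_config (hX : ∀ n, Measurable (X n)) : Measurable (config X) := by
  refine Measure.measurable_of_measurable_coe _ fun A hA => ?_
  simp_rw [← lintegral_indicator_one hA, lintegral_config (measurable_one.indicator hA)]
  exact Measurable.tsum fun n => (measurable_one.indicator hA).comp (hX n)

lemma measurable_config_apply (hX : ∀ n, Measurable (X n)) {A : Set Plane}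
    (hA : MeasurableSet A) : Measurable fun ω => config X ω A :=
  (Measure.measurable_coe hA).comp (measurable_config hX)

lemma measurable_lintegral_config (hX : ∀ n, Measurable (X n)) (hψ : Measurable ψ) :
    Measurable fun ω => ∫⁻ y, ψ y ∂config X ω :=
  (Measure.measurable_lintegral hψ).comp (measurable_config hX)

/-- The Laplace functional `E[exp (-∑ₙ ψ(Xₙ))]` of a point configuration at the test function
`ψ`. -/
noncomputable def laplaceFunctional (X : ℕ → Ω → Plane) (P : Measure Ω) (ψ : Plane → ℝ≥0∞) :
    ℝ≥0∞ :=
  ∫⁻ ω, eexpNeg (∫⁻ y, ψ y ∂config X ω) ∂P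

/-- The value at `ψ` of the Laplace functional of a Poisson configuration of density `lam`. -/
noncomputable def poissonLaplace (lam : ℝ) (ψ : Plane → ℝ≥0∞) : ℝ≥0∞ :=
  eexpNeg (ENNReal.ofReal lam * ∫⁻ y, (1 - eexpNeg (ψ y)))

lemma tendsto_laplaceFunctional {P : Measure Ω} [IsFiniteMeasure P] (hX : ∀ n, Measurable (X n))
    {f : ℕ → Plane → ℝ≥0∞} (hf : ∀ n, Measurable (f n)) (hmono : Monotone f)
    (hlim : ∀ y, Tendsto (fun n => f n y) atTop (𝓝 (ψ y))) :
    Tendsto (fun n => laplaceFunctional X P (f n)) atTop (𝓝 (laplaceFunctional X P ψ)) := by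
  refine tendsto_lintegral_of_dominated_convergence (fun _ => 1)
    (fun n => measurable_eexpNeg.comp (measurable_lintegral_config hX (hf n)))
    (fun n => .of_forall fun _ => eexpNeg_le_one _) (by simp) (.of_forall fun ω => ?_)
  exact (continuous_eexpNeg.tendsto _).comp
    (lintegral_tendsto_of_tendsto_of_monotone (fun n => (hf n).aemeasurable)
      (.of_forall fun y _ _ hmn => hmono hmn y) (.of_forall hlim))

lemma tendsto_poissonLaplace (lam : ℝ) {f : ℕ → Plane → ℝ≥0∞} (hf : ∀ n, Measurable (f n))
    (hmono : Monotone f) (hlim : ∀ y, Tendsto (fun n => f n y) atTop (𝓝 (ψ y))) :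
    Tendsto (fun n => poissonLaplace lam (f n)) atTop (𝓝 (poissonLaplace lam ψ)) := by
  refine (continuous_eexpNeg.tendsto _).comp (ENNReal.Tendsto.const_mul
    (lintegral_tendsto_of_tendsto_of_monotone
      (fun n => ((measurable_eexpNeg.comp (hf n)).const_sub 1).aemeasurable)
      (.of_forall fun y m n hmn => tsub_le_tsub_left (antitone_eexpNeg (hmono hmn y)) 1)
      (.of_forall fun y => ?_)) (Or.inr ENNReal.ofReal_ne_top))
  exact ENNReal.Tendsto.sub tendsto_const_nhds ((continuous_eexpNeg.tendsto _).comp (hlim y))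
    (Or.inl ENNReal.one_ne_top)

lemma poissonLaplace_ne_top (lam : ℝ) (ψ : Plane → ℝ≥0∞) : poissonLaplace lam ψ ≠ ∞ :=
  eexpNeg_ne_top _

lemma poissonLaplace_add_indicator (lam : ℝ) (hψ : Measurable ψ) {B : Set Plane}
    (hB : MeasurableSet B) (t : ℝ≥0∞) :
    poissonLaplace lam (fun y => ψ y + B.indicator (fun _ => t) y) =
      poissonLaplace lam ψ *
        eexpNeg (ENNReal.ofReal lam * ((1 - eexpNeg t) * ∫⁻ y in B, eexpNeg (ψ y))) := by
  have hexp : Measurable fun y => eexpNeg (ψ y) := measurable_eexpNeg.comp hψ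
  rw [poissonLaplace, poissonLaplace, ← eexpNeg_add, ← mul_add, ← lintegral_indicator hB,
    ← lintegral_const_mul _ (hexp.indicator hB), ← lintegral_add_left (hexp.const_sub 1)]
  simp_rw [one_sub_eexpNeg_add]
  congr 3 with y
  by_cases hy : y ∈ B <;> simp [hy, eexpNeg_zero]

end Config

lemma coe_toNNReal_mul_toReal (lam : ℝ) {a : ℝ≥0∞} (ha : a ≠ ∞) :
    ((lam * a.toReal).toNNReal : ℝ≥0∞) = ENNReal.ofReal lam * a := by
  rw [← ENNReal.ofReal, ENNReal.ofReal_mul' ENNReal.toReal_nonneg, ENNReal.ofReal_toReal ha]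

namespace IsHomogeneousPPP

variable {Ω : Type*} [MeasurableSpace Ω] {lam : ℝ} {X : ℕ → Ω → Plane} {P : Measure Ω}

lemma lintegral_comp_count (h : IsHomogeneousPPP lam X P) {A : Set Plane}
    (hA : MeasurableSet A) (hAf : volume A ≠ ∞) {f : ℝ≥0∞ → ℝ≥0∞} (hf : Measurable f) :
    ∫⁻ ω, f (config X ω A) ∂P =
      ∫⁻ k : ℕ, f k ∂poissonMeasure (lam * (volume A).toReal).toNNReal := by
  rw [(h.count_law A hA hAf).lintegral_comp hf.aemeasurable, lintegral_map hf measurable_from_nat]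

lemma lintegral_count (h : IsHomogeneousPPP lam X P) {A : Set Plane}
    (hA : MeasurableSet A) (hAf : volume A ≠ ∞) :
    ∫⁻ ω, config X ω A ∂P = ENNReal.ofReal lam * volume A := by
  rw [h.lintegral_comp_count hA hAf measurable_id', lintegral_natCast_poissonMeasure,
    coe_toNNReal_mul_toReal lam hAf]

lemma lintegral_eexpNeg_mul_count (h : IsHomogeneousPPP lam X P) {A : Set Plane}
    (hA : MeasurableSet A) (hAf : volume A ≠ ∞) (c : ℝ≥0∞) :
    ∫⁻ ω, eexpNeg (c * config X ω A) ∂P =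
      eexpNeg (ENNReal.ofReal lam * ((1 - eexpNeg c) * volume A)) := by
  rw [h.lintegral_comp_count hA hAf (f := fun x => eexpNeg (c * x)) (by fun_prop),
    lintegral_eexpNeg_mul_poissonMeasure, coe_toNNReal_mul_toReal lam hAf]
  congr 1; ring

lemma iIndepFun_count (h : IsHomogeneousPPP lam X P) {ι : Type*} [Finite ι] (A : ι → Set Plane)
    (hA : ∀ i, MeasurableSet (A i)) (hd : Pairwise (Function.onFun Disjoint A)) :
    iIndepFun (fun i ω => config X ω (A i)) P := by
  obtain ⟨k, ⟨e⟩⟩ := Finite.exists_equiv_fin ι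
  simpa using (h.count_indep k (fun j => A (e.symm j)) (fun j => hA _) fun i j hij =>
    hd (e.symm.injective.ne hij)).precomp e.injective

lemma lintegral_eexpNeg_sum_mul_count (h : IsHomogeneousPPP lam X P) {ι : Type*} [Fintype ι]
    (A : ι → Set Plane) (hA : ∀ i, MeasurableSet (A i)) (hAf : ∀ i, volume (A i) ≠ ∞)
    (hd : Pairwise (Function.onFun Disjoint A)) (c : ι → ℝ≥0∞) :
    ∫⁻ ω, eexpNeg (∑ i, c i * config X ω (A i)) ∂P =
      eexpNeg (ENNReal.ofReal lam * ∑ i, (1 - eexpNeg (c i)) * volume (A i)) := by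
  have hindep := (h.iIndepFun_count A hA hd).comp (fun i x => eexpNeg (c i * x))
    fun i => by fun_prop
  simp_rw [Finset.mul_sum, eexpNeg_sum, ← h.lintegral_eexpNeg_mul_count (hA _) (hAf _)]
  exact lintegral_prod_eq_prod_lintegral_of_indepFun Finset.univ _ hindep fun i =>
    measurable_eexpNeg.comp ((measurable_config_apply h.measurable (hA i)).const_mul _)

lemma laplaceFunctional_simpleFunc (h : IsHomogeneousPPP lam X P)
    (f : SimpleFunc Plane ℝ≥0∞) (hf : ∀ c, c ≠ 0 → volume (f ⁻¹' {c}) ≠ ∞) :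
    laplaceFunctional X P f = poissonLaplace lam f := by
  classical
  let s := f.range.filter (· ≠ 0)
  have hsum (ω : Ω) : ∫⁻ y, f y ∂config X ω = ∑ c : s, c * config X ω (f ⁻¹' {(c : ℝ≥0∞)}) := by
    rw [SimpleFunc.lintegral_eq_lintegral, SimpleFunc.lintegral,
      Finset.sum_coe_sort s fun c => c * config X ω (f ⁻¹' {c}), Finset.sum_filter_of_ne]
    exact fun c _ hc => left_ne_zero_of_mul hc
  have hsum' : ∫⁻ y, (1 - eexpNeg (f y)) =
      ∑ c : s, (1 - eexpNeg c) * volume (f ⁻¹' {(c : ℝ≥0∞)}) := by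
    have hmap := SimpleFunc.lintegral_eq_lintegral (f.map fun c => 1 - eexpNeg c) volume
    rw [SimpleFunc.map_lintegral] at hmap
    simp only [SimpleFunc.map_apply] at hmap
    rw [hmap, Finset.sum_coe_sort s fun c => (1 - eexpNeg c) * volume (f ⁻¹' {c}),
      Finset.sum_filter_of_ne]
    rintro c - hc rfl
    simp [eexpNeg_zero] at hc
  simp_rw [laplaceFunctional, poissonLaplace, hsum, hsum']
  refine h.lintegral_eexpNeg_sum_mul_count (fun c : s => f ⁻¹' {(c : ℝ≥0∞)})
    (fun c => f.measurableSet_fiber c) (fun c => hf c (Finset.mem_filter.1 c.2).2)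
    (fun c d hcd => ?_) (fun c : s => (c : ℝ≥0∞))
  exact (disjoint_singleton.2 (Subtype.coe_injective.ne hcd)).preimage f

theorem laplaceFunctional_eq [IsProbabilityMeasure P] (h : IsHomogeneousPPP lam X P)
    {ψ : Plane → ℝ≥0∞} (hψ : Measurable ψ) :
    laplaceFunctional X P ψ = poissonLaplace lam ψ := by
  obtain ⟨f, hmono, hfin, hlim⟩ := exists_monotone_simpleFunc_tendsto volume hψ
  have hX := tendsto_laplaceFunctional (P := P) h.measurable (fun n => (f n).measurable) hmono hlim
  simp_rw [fun n => h.laplaceFunctional_simpleFunc (f n) (hfin n)] at hX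
  exact tendsto_nhds_unique hX
    (tendsto_poissonLaplace lam (fun n => (f n).measurable) hmono hlim)

end IsHomogeneousPPP

lemma tendsto_natCast_mul_lintegral_eexpNeg_sub {α : Type*} [MeasurableSpace α] {μ : Measure α}
    [IsFiniteMeasure μ] {C S : α → ℝ≥0∞} (hC : Measurable C) (hS : Measurable S)
    (hCf : ∫⁻ a, C a ∂μ ≠ ∞) :
    Tendsto (fun n : ℕ => (n : ℝ≥0∞) *
        ((∫⁻ a, eexpNeg (S a) ∂μ) - ∫⁻ a, eexpNeg (S a + (n : ℝ≥0∞)⁻¹ * C a) ∂μ))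
      atTop (𝓝 (∫⁻ a, C a * eexpNeg (S a) ∂μ)) := by
  have hquot (n : ℕ) : (n : ℝ≥0∞) *
        ((∫⁻ a, eexpNeg (S a) ∂μ) - ∫⁻ a, eexpNeg (S a + (n : ℝ≥0∞)⁻¹ * C a) ∂μ) =
      ∫⁻ a, n * (1 - eexpNeg ((n : ℝ≥0∞)⁻¹ * C a)) * eexpNeg (S a) ∂μ := by
    simp_rw [mul_assoc]
    rw [lintegral_const_mul' _ _ (ENNReal.natCast_ne_top n)]
    simp_rw [one_sub_eexpNeg_mul_eexpNeg]
    rw [lintegral_sub (by fun_prop) _ (.of_forall fun a => antitone_eexpNeg le_self_add)]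
    exact ((lintegral_mono fun a => eexpNeg_le_one _).trans_lt (by simp)).ne
  simp_rw [hquot]
  refine tendsto_lintegral_of_dominated_convergence C (fun n => by fun_prop)
    (fun n => .of_forall fun a => ?_) hCf ?_
  · calc (n : ℝ≥0∞) * (1 - eexpNeg ((n : ℝ≥0∞)⁻¹ * C a)) * eexpNeg (S a)
        ≤ n * ((n : ℝ≥0∞)⁻¹ * C a) * 1 := by
          gcongr
          exacts [one_sub_eexpNeg_le _, eexpNeg_le_one _]
      _ ≤ 1 * C a := by
          rw [mul_one, ← mul_assoc]
          gcongr
          exact ENNReal.mul_inv_le_one _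
      _ = C a := one_mul _
  · filter_upwards [ae_lt_top hC hCf] with a ha
    exact ENNReal.Tendsto.mul_const (tendsto_natCast_mul_one_sub_eexpNeg_inv_mul ha.ne)
      (Or.inr (eexpNeg_ne_top _))

lemma setLIntegral_eexpNeg_ne_top {B : Set Plane} (hB : volume B ≠ ∞) (ψ : Plane → ℝ≥0∞) :
    ∫⁻ y in B, eexpNeg (ψ y) ≠ ∞ :=
  ((lintegral_mono fun y => eexpNeg_le_one (ψ y)).trans_lt (by simpa using hB.lt_top)).ne

lemma tendsto_natCast_mul_poissonLaplace_sub (lam : ℝ) {ψ : Plane → ℝ≥0∞} (hψ : Measurable ψ)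
    {B : Set Plane} (hB : MeasurableSet B) (hBf : volume B ≠ ∞) :
    Tendsto (fun n : ℕ => (n : ℝ≥0∞) * (poissonLaplace lam ψ -
        poissonLaplace lam fun y => ψ y + B.indicator (fun _ => (n : ℝ≥0∞)⁻¹) y))
      atTop (𝓝 (ENNReal.ofReal lam * (∫⁻ y in B, eexpNeg (ψ y)) * poissonLaplace lam ψ)) := by
  have hrate : Tendsto (fun n : ℕ => (n : ℝ≥0∞) *
        (ENNReal.ofReal lam * ((1 - eexpNeg (n : ℝ≥0∞)⁻¹) * ∫⁻ y in B, eexpNeg (ψ y))))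
      atTop (𝓝 (ENNReal.ofReal lam * ∫⁻ y in B, eexpNeg (ψ y))) := by
    have h := ENNReal.Tendsto.mul_const (b := ENNReal.ofReal lam * ∫⁻ y in B, eexpNeg (ψ y))
      (tendsto_natCast_mul_one_sub_eexpNeg_inv_mul ENNReal.one_ne_top) (Or.inl one_ne_zero)
    simp only [mul_one, one_mul] at h
    exact h.congr fun n => by ring
  refine (ENNReal.Tendsto.mul_const (tendsto_natCast_mul_one_sub_eexpNeg
    (ENNReal.mul_ne_top ENNReal.ofReal_ne_top (setLIntegral_eexpNeg_ne_top hBf ψ)) hrate)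
    (Or.inr (poissonLaplace_ne_top lam ψ))).congr fun n => ?_
  rw [poissonLaplace_add_indicator lam hψ hB, mul_assoc,
    ENNReal.sub_mul fun _ _ => poissonLaplace_ne_top lam ψ, one_mul, mul_comm (eexpNeg _)]

-- Campbell's formula, by differentiating the Laplace functional at `ψ` in the direction `1_B`.
theorem IsHomogeneousPPP.lintegral_count_mul_eexpNeg {Ω : Type*} [MeasurableSpace Ω] {lam : ℝ}
    {X : ℕ → Ω → Plane} {P : Measure Ω} [IsProbabilityMeasure P] (h : IsHomogeneousPPP lam X P)
    {ψ : Plane → ℝ≥0∞} (hψ : Measurable ψ)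
    {B : Set Plane} (hB : MeasurableSet B) (hBf : volume B ≠ ∞) :
    ∫⁻ ω, config X ω B * eexpNeg (∫⁻ y, ψ y ∂config X ω) ∂P =
      ENNReal.ofReal lam * (∫⁻ y in B, eexpNeg (ψ y)) * poissonLaplace lam ψ := by
  have hmean : ∫⁻ ω, config X ω B ∂P ≠ ∞ :=
    h.lintegral_count hB hBf ▸ ENNReal.mul_ne_top ENNReal.ofReal_ne_top hBf
  refine tendsto_nhds_unique (tendsto_natCast_mul_lintegral_eexpNeg_sub
    (measurable_config_apply h.measurable hB) (measurable_lintegral_config h.measurable hψ) hmean)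
    ((tendsto_natCast_mul_poissonLaplace_sub lam hψ hB hBf).congr fun n => ?_)
  rw [← h.laplaceFunctional_eq hψ,
    ← h.laplaceFunctional_eq (show Measurable fun y => ψ y + B.indicator (fun _ => (n : ℝ≥0∞)⁻¹) y
      from hψ.add (measurable_const.indicator hB))]
  simp_rw [laplaceFunctional, lintegral_add_left hψ, lintegral_indicator_const hB]

/-! ### Slivnyak's theorem -/

lemma exists_ball_translate_le {E : Type*} [SeminormedAddCommGroup E] {w : E → ℝ≥0}
    (hw : Continuous w) (hc : HasCompactSupport w) :
    ∃ R : ℝ, ∀ η : ℝ≥0, 0 < η → ∃ r : ℝ, 0 < r ∧ ∀ x ∈ Metric.ball (0 : E) r, ∀ y,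
      (w (y - x) : ℝ≥0∞) ≤ w y + (Metric.closedBall 0 R).indicator (fun _ => (η : ℝ≥0∞)) y ∧
      (w y : ℝ≥0∞) ≤ w (y - x) + (Metric.closedBall 0 R).indicator (fun _ => (η : ℝ≥0∞)) y := by
  obtain ⟨R, hR⟩ := hc.isCompact.isBounded.subset_closedBall (0 : E)
  have hzero (y : E) (hy : R < ‖y‖) : w y = 0 := by
    by_contra h
    exact hy.not_ge (mem_closedBall_zero_iff.1 (hR (subset_tsupport _ h)))
  refine ⟨R + 1, fun η hη => ?_⟩
  obtain ⟨r, hr, hdist⟩ := Metric.uniformContinuous_iff.1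
    (hc.uniformContinuous_of_continuous hw) η (by exact_mod_cast hη)
  refine ⟨min r 1, by positivity, fun x hx y => ?_⟩
  rw [mem_ball_zero_iff, lt_min_iff] at hx
  by_cases hy : y ∈ Metric.closedBall (0 : E) (R + 1)
  · have hclose : dist (w (y - x)) (w y) < η := hdist (by simpa [dist_eq_norm] using hx.1)
    rw [NNReal.dist_eq, abs_lt] at hclose
    rw [indicator_of_mem hy]
    norm_cast
    constructor <;> rw [← NNReal.coe_le_coe] <;> push_cast <;> linarith
  · rw [mem_closedBall_zero_iff, not_le] at hy
    have hyx : ‖y‖ ≤ ‖y - x‖ + ‖x‖ := by simpa using norm_add_le (y - x) x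
    rw [hzero y (by linarith), hzero (y - x) (by linarith)]
    simp

lemma exists_monotone_hasCompactSupport_tendsto {E : Type*} [SeminormedAddCommGroup E]
    [ProperSpace E] {w : E → ℝ≥0} (hw : Continuous w) :
    ∃ f : ℕ → E → ℝ≥0, (∀ k, Continuous (f k)) ∧ (∀ k, HasCompactSupport (f k)) ∧ Monotone f ∧
      ∀ y, Tendsto (fun k => f k y) atTop (𝓝 (w y)) := by
  refine ⟨fun k y => w y * min 1 (Real.toNNReal (k - ‖y‖)), fun k => by fun_prop,
    fun k => HasCompactSupport.intro (isCompact_closedBall (0 : E) k) fun y hy => ?_,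
    fun k m hkm y => by dsimp only; gcongr, fun y => tendsto_const_nhds.congr' ?_⟩
  · rw [mem_closedBall_zero_iff, not_le] at hy
    simp only [Real.toNNReal_of_nonpos (sub_nonpos.2 hy.le), min_eq_right zero_le_one, mul_zero]
  · obtain ⟨m, hm⟩ := exists_nat_ge (‖y‖ + 1)
    filter_upwards [eventually_ge_atTop m] with k hk
    have hmk : (m : ℝ) ≤ k := by exact_mod_cast hk
    simp only [min_eq_left (Real.one_le_toNNReal.2 (show 1 ≤ (k : ℝ) - ‖y‖ by linarith)), mul_one]

lemma lintegral_eexpNeg_mul_le {α : Type*} [MeasurableSpace α] (μ : Measure α)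
    {χ : α → ℝ≥0∞} {a c : ℝ≥0∞} {B : Set α} (h : ∀ y ∈ B, a ≤ χ y + c) :
    (∫⁻ y in B, eexpNeg (χ y) ∂μ) * eexpNeg c ≤ μ B * eexpNeg a := by
  rw [← lintegral_mul_const' _ _ (eexpNeg_ne_top c), mul_comm, ← setLIntegral_const]
  refine setLIntegral_mono measurable_const fun y hy => ?_
  rw [← eexpNeg_add]
  exact antitone_eexpNeg (h y hy)

lemma mul_le_lintegral_eexpNeg {α : Type*} [MeasurableSpace α] (μ : Measure α)
    {χ : α → ℝ≥0∞} (hχ : Measurable χ) {a c : ℝ≥0∞} {B : Set α}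
    (h : ∀ y ∈ B, χ y ≤ a + c) :
    μ B * eexpNeg a * eexpNeg c ≤ ∫⁻ y in B, eexpNeg (χ y) ∂μ := by
  rw [mul_assoc, ← eexpNeg_add, mul_comm, ← setLIntegral_const]
  exact setLIntegral_mono (measurable_eexpNeg.comp hχ) fun y hy => antitone_eexpNeg (h y hy)

lemma poissonLaplace_mul_le (lam : ℝ) {χ ψ : Plane → ℝ≥0∞} {K : Set Plane}
    (hK : MeasurableSet K) {η : ℝ≥0∞} (h : ∀ y, ψ y ≤ χ y + K.indicator (fun _ => η) y) :
    poissonLaplace lam χ * eexpNeg (ENNReal.ofReal lam * volume K * η) ≤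
      poissonLaplace lam ψ := by
  rw [poissonLaplace, poissonLaplace, ← eexpNeg_add, mul_assoc, ← mul_add, mul_comm (volume K),
    ← lintegral_indicator_const hK, ← lintegral_add_right _ (measurable_const.indicator hK)]
  refine antitone_eexpNeg ?_
  gcongr with y
  exact (tsub_le_tsub_left (antitone_eexpNeg (h y)) 1).trans (one_sub_eexpNeg_add_le _ _)

namespace IsPalmVersion

variable {Ω Ω₀ : Type*} [MeasurableSpace Ω] [MeasurableSpace Ω₀] {lam : ℝ} {Φ : ℕ → Ω₀ → Plane}
  {P₀ : Measure Ω₀} {X : ℕ → Ω → Plane} {P : Measure Ω}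

lemma laplaceFunctional_eq_mul (h : IsPalmVersion lam Φ P₀ X P) {ψ : Plane → ℝ≥0∞}
    (hψ : Measurable ψ) :
    laplaceFunctional X P ψ =
      eexpNeg (ψ 0) * laplaceFunctional (fun n => X (n + 1)) P ψ := by
  rw [laplaceFunctional, laplaceFunctional, ← lintegral_const_mul' _ _ (eexpNeg_ne_top _)]
  refine lintegral_congr_ae ?_
  filter_upwards [h.typical_at_origin] with ω hω
  rw [lintegral_config hψ, lintegral_config hψ, tsum_eq_zero_add' ENNReal.summable, hω,
    eexpNeg_add]

lemma sum_map_config_sub (h : IsPalmVersion lam Φ P₀ X P) (hΦ : ∀ n, Measurable (Φ n))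
    {B : Set Plane} (hB : MeasurableSet B) :
    Measure.sum (fun n => (P₀.restrict (Φ n ⁻¹' B)).map (config fun m ω => Φ m ω - Φ n ω)) =
      (ENNReal.ofReal lam * volume B) • P.map (config X) := by
  have hconfig (n : ℕ) : Measurable (config fun m ω => Φ m ω - Φ n ω) :=
    measurable_config fun m => (hΦ m).sub (hΦ n)
  ext 𝒜 h𝒜
  rw [Measure.smul_apply, Measure.map_apply (measurable_config h.measurable) h𝒜, smul_eq_mul]
  refine Eq.trans ?_ (h.palm B 𝒜 hB h𝒜)
  have hset (n : ℕ) : MeasurableSet {ω | Φ n ω ∈ B ∧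
      config (fun m ω' => Φ m ω' - Φ n ω') ω ∈ 𝒜} := (hΦ n hB).inter (hconfig n h𝒜)
  rw [Measure.sum_apply _ h𝒜,
    lintegral_tsum fun n => (measurable_const.indicator (hset n)).aemeasurable]
  refine tsum_congr fun n => ?_
  rw [Measure.map_apply (hconfig n) h𝒜, Measure.restrict_apply (hconfig n h𝒜),
    lintegral_indicator_const (hset n), one_mul, inter_comm]
  rfl

lemma lintegral_tsum_indicator_mul (h : IsPalmVersion lam Φ P₀ X P)
    (hΦ : ∀ n, Measurable (Φ n)) {B : Set Plane} (hB : MeasurableSet B)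
    {F : Measure Plane → ℝ≥0∞} (hF : Measurable F) :
    ∫⁻ ω, ∑' n, B.indicator 1 (Φ n ω) * F (config (fun m ω' => Φ m ω' - Φ n ω') ω) ∂P₀ =
      ENNReal.ofReal lam * volume B * ∫⁻ ω, F (config X ω) ∂P := by
  have hconfig (n : ℕ) : Measurable (config fun m ω => Φ m ω - Φ n ω) :=
    measurable_config fun m => (hΦ m).sub (hΦ n)
  have hterm (n : ℕ) : Measurable fun ω => B.indicator (1 : Plane → ℝ≥0∞) (Φ n ω) *
      F (config (fun m ω' => Φ m ω' - Φ n ω') ω) :=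
    ((measurable_one.indicator hB).comp (hΦ n)).mul (hF.comp (hconfig n))
  rw [← lintegral_map hF (measurable_config h.measurable), ← smul_eq_mul,
    ← lintegral_smul_measure, ← h.sum_map_config_sub hΦ hB, lintegral_sum_measure,
    lintegral_tsum fun n => (hterm n).aemeasurable]
  refine tsum_congr fun n => ?_
  rw [lintegral_map hF (hconfig n), ← lintegral_indicator (hΦ n hB)]
  refine lintegral_congr fun ω => ?_
  by_cases hω : Φ n ω ∈ B <;> simp [indicator, hω]

lemma lintegral_tsum_indicator_mul_eexpNeg (h : IsPalmVersion lam Φ P₀ X P)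
    (hΦ : ∀ n, Measurable (Φ n)) {B : Set Plane} (hB : MeasurableSet B)
    {ψ : Plane → ℝ≥0∞} (hψ : Measurable ψ) :
    ∫⁻ ω, ∑' n, B.indicator 1 (Φ n ω) * eexpNeg (∑' m, ψ (Φ m ω - Φ n ω)) ∂P₀ =
      ENNReal.ofReal lam * volume B * laplaceFunctional X P ψ := by
  have hpalm := h.lintegral_tsum_indicator_mul hΦ hB (F := fun μ => eexpNeg (∫⁻ y, ψ y ∂μ))
    (measurable_eexpNeg.comp (Measure.measurable_lintegral hψ))
  simpa only [laplaceFunctional, lintegral_config hψ] using hpalm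

end IsPalmVersion

lemma IsHomogeneousPPP.lintegral_tsum_indicator_mul_eexpNeg {Ω : Type*} [MeasurableSpace Ω]
    {lam : ℝ} {X : ℕ → Ω → Plane} {P : Measure Ω} [IsProbabilityMeasure P]
    (h : IsHomogeneousPPP lam X P) {B : Set Plane} (hB : MeasurableSet B) (hBf : volume B ≠ ∞)
    {ψ : Plane → ℝ≥0∞} (hψ : Measurable ψ) :
    ∫⁻ ω, ∑' n, B.indicator 1 (X n ω) * eexpNeg (∑' m, ψ (X m ω)) ∂P =
      ENNReal.ofReal lam * (∫⁻ y in B, eexpNeg (ψ y)) * poissonLaplace lam ψ := by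
  rw [← h.lintegral_count_mul_eexpNeg hψ hB hBf]
  refine lintegral_congr fun ω => ?_
  rw [ENNReal.tsum_mul_right, lintegral_config hψ, ← lintegral_indicator_one hB,
    lintegral_config (measurable_one.indicator hB)]

namespace IsPalmVersion

variable {Ω Ω₀ : Type*} [MeasurableSpace Ω] [MeasurableSpace Ω₀] {lam : ℝ} {Φ : ℕ → Ω₀ → Plane}
  {P₀ : Measure Ω₀} [IsProbabilityMeasure P₀] {X : ℕ → Ω → Plane} {P : Measure Ω}
  {B : Set Plane} {χ ψ : Plane → ℝ≥0∞}

lemma volume_mul_laplaceFunctional_le (h : IsPalmVersion lam Φ P₀ X P)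
    (hΦ : IsHomogeneousPPP lam Φ P₀) (hlam : 0 < lam) (hB : MeasurableSet B)
    (hBf : volume B ≠ ∞) (hχ : Measurable χ) (hψ : Measurable ψ)
    (hle : ∀ x ∈ B, ∀ y, χ y ≤ ψ (y - x)) :
    volume B * laplaceFunctional X P ψ ≤ (∫⁻ y in B, eexpNeg (χ y)) * poissonLaplace lam χ := by
  rw [← ENNReal.mul_le_mul_iff_right (ENNReal.ofReal_pos.2 hlam).ne' ENNReal.ofReal_ne_top,
    ← mul_assoc, ← mul_assoc, ← h.lintegral_tsum_indicator_mul_eexpNeg hΦ.measurable hB hψ,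
    ← hΦ.lintegral_tsum_indicator_mul_eexpNeg hB hBf hχ]
  refine lintegral_mono fun ω => ENNReal.tsum_le_tsum fun n => ?_
  by_cases hn : Φ n ω ∈ B
  · gcongr
    exact antitone_eexpNeg (ENNReal.tsum_le_tsum fun m => hle _ hn _)
  · simp [hn]

lemma le_volume_mul_laplaceFunctional (h : IsPalmVersion lam Φ P₀ X P)
    (hΦ : IsHomogeneousPPP lam Φ P₀) (hlam : 0 < lam) (hB : MeasurableSet B)
    (hBf : volume B ≠ ∞) (hχ : Measurable χ) (hψ : Measurable ψ)
    (hle : ∀ x ∈ B, ∀ y, ψ (y - x) ≤ χ y) :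
    (∫⁻ y in B, eexpNeg (χ y)) * poissonLaplace lam χ ≤ volume B * laplaceFunctional X P ψ := by
  rw [← ENNReal.mul_le_mul_iff_right (ENNReal.ofReal_pos.2 hlam).ne' ENNReal.ofReal_ne_top,
    ← mul_assoc, ← mul_assoc, ← h.lintegral_tsum_indicator_mul_eexpNeg hΦ.measurable hB hψ,
    ← hΦ.lintegral_tsum_indicator_mul_eexpNeg hB hBf hχ]
  refine lintegral_mono fun ω => ENNReal.tsum_le_tsum fun n => ?_
  by_cases hn : Φ n ω ∈ B
  · gcongr
    exact antitone_eexpNeg (ENNReal.tsum_le_tsum fun m => hle _ hn _)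
  · simp [hn]

variable {w : Plane → ℝ≥0∞} {K : Set Plane} {η : ℝ≥0∞}

lemma laplaceFunctional_mul_eexpNeg_le (h : IsPalmVersion lam Φ P₀ X P)
    (hΦ : IsHomogeneousPPP lam Φ P₀) (hlam : 0 < lam) (hB : MeasurableSet B)
    (hB0 : volume B ≠ 0) (hBf : volume B ≠ ∞) (hw : Measurable w) (hK : MeasurableSet K)
    (hle : ∀ x ∈ B, ∀ y, w (y - x) ≤ w y + K.indicator (fun _ => η) y)
    (hge : ∀ x ∈ B, ∀ y, w y ≤ w (y - x) + K.indicator (fun _ => η) y) :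
    laplaceFunctional X P w * eexpNeg ((2 + ENNReal.ofReal lam * volume K) * η) ≤
      eexpNeg (w 0) * poissonLaplace lam w := by
  let χ : Plane → ℝ≥0∞ := fun y => w y - K.indicator (fun _ => η) y
  have hχ : Measurable χ := hw.sub (measurable_const.indicator hK)
  have hcompare := h.volume_mul_laplaceFunctional_le hΦ hlam hB hBf hχ hw
    fun x hx y => tsub_le_iff_right.2 (hge x hx y)
  have horigin : ∀ y ∈ B, w 0 ≤ χ y + 2 * η := fun y hy => by
    have hK_le : K.indicator (fun _ => η) y ≤ η := indicator_le_self' (fun _ _ => zero_le) y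
    calc w 0 ≤ w y + K.indicator (fun _ => η) y := by simpa using hle y hy y
      _ ≤ χ y + K.indicator (fun _ => η) y + K.indicator (fun _ => η) y := by
          gcongr; exact le_tsub_add
      _ ≤ χ y + η + η := by gcongr
      _ = χ y + 2 * η := by ring
  rw [← ENNReal.mul_le_mul_iff_right hB0 hBf]
  calc volume B * (laplaceFunctional X P w *
          eexpNeg ((2 + ENNReal.ofReal lam * volume K) * η))
      = volume B * laplaceFunctional X P w *
          (eexpNeg (2 * η) * eexpNeg (ENNReal.ofReal lam * volume K * η)) := by
        rw [add_mul, eexpNeg_add]; ring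
    _ ≤ (∫⁻ y in B, eexpNeg (χ y)) * poissonLaplace lam χ *
          (eexpNeg (2 * η) * eexpNeg (ENNReal.ofReal lam * volume K * η)) := by gcongr
    _ = (∫⁻ y in B, eexpNeg (χ y)) * eexpNeg (2 * η) *
          (poissonLaplace lam χ * eexpNeg (ENNReal.ofReal lam * volume K * η)) := by ring
    _ ≤ volume B * eexpNeg (w 0) * poissonLaplace lam w := by
        exact mul_le_mul' (lintegral_eexpNeg_mul_le _ horigin)
          (poissonLaplace_mul_le lam hK fun y => le_tsub_add)
    _ = volume B * (eexpNeg (w 0) * poissonLaplace lam w) := mul_assoc _ _ _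

lemma mul_eexpNeg_le_laplaceFunctional (h : IsPalmVersion lam Φ P₀ X P)
    (hΦ : IsHomogeneousPPP lam Φ P₀) (hlam : 0 < lam) (hB : MeasurableSet B)
    (hB0 : volume B ≠ 0) (hBf : volume B ≠ ∞) (hw : Measurable w) (hK : MeasurableSet K)
    (hle : ∀ x ∈ B, ∀ y, w (y - x) ≤ w y + K.indicator (fun _ => η) y)
    (hge : ∀ x ∈ B, ∀ y, w y ≤ w (y - x) + K.indicator (fun _ => η) y) :
    eexpNeg (w 0) * poissonLaplace lam w *
        eexpNeg ((2 + ENNReal.ofReal lam * volume K) * η) ≤ laplaceFunctional X P w := by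
  let χ : Plane → ℝ≥0∞ := fun y => w y + K.indicator (fun _ => η) y
  have hχ : Measurable χ := hw.add (measurable_const.indicator hK)
  have hcompare := h.le_volume_mul_laplaceFunctional hΦ hlam hB hBf hχ hw hle
  have horigin : ∀ y ∈ B, χ y ≤ w 0 + 2 * η := fun y hy => by
    have hK_le : K.indicator (fun _ => η) y ≤ η := indicator_le_self' (fun _ _ => zero_le) y
    calc χ y ≤ w 0 + K.indicator (fun _ => η) y + K.indicator (fun _ => η) y := by
          simp only [χ]; gcongr; simpa using hge y hy y
      _ ≤ w 0 + η + η := by gcongr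
      _ = w 0 + 2 * η := by ring
  rw [← ENNReal.mul_le_mul_iff_right hB0 hBf]
  calc volume B * (eexpNeg (w 0) * poissonLaplace lam w *
          eexpNeg ((2 + ENNReal.ofReal lam * volume K) * η))
      = volume B * eexpNeg (w 0) * eexpNeg (2 * η) *
          (poissonLaplace lam w * eexpNeg (ENNReal.ofReal lam * volume K * η)) := by
        rw [add_mul, eexpNeg_add]; ring
    _ ≤ (∫⁻ y in B, eexpNeg (χ y)) * poissonLaplace lam χ := by
        exact mul_le_mul' (mul_le_lintegral_eexpNeg _ hχ horigin)
          (poissonLaplace_mul_le lam hK fun y => le_rfl)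
    _ ≤ volume B * laplaceFunctional X P w := hcompare

lemma laplaceFunctional_of_hasCompactSupport [IsProbabilityMeasure P]
    (h : IsPalmVersion lam Φ P₀ X P) (hΦ : IsHomogeneousPPP lam Φ P₀) (hlam : 0 < lam)
    {w : Plane → ℝ≥0} (hw : Continuous w) (hc : HasCompactSupport w) :
    laplaceFunctional X P (fun y => w y) =
      eexpNeg (w 0) * poissonLaplace lam fun y => w y := by
  obtain ⟨R, hR⟩ := exists_ball_translate_le hw hc
  have hwm : Measurable fun y => (w y : ℝ≥0∞) := hw.measurable.coe_nnreal_ennreal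
  have hconst : 2 + ENNReal.ofReal lam * volume (Metric.closedBall (0 : Plane) R) ≠ ∞ :=
    ENNReal.add_ne_top.2 ⟨by simp,
      ENNReal.mul_ne_top ENNReal.ofReal_ne_top measure_closedBall_lt_top.ne⟩
  have hfinite : laplaceFunctional X P (fun y => w y) ≠ ∞ :=
    ((lintegral_mono fun ω => eexpNeg_le_one _).trans_lt (by simp)).ne
  refine le_antisymm (le_of_forall_mul_eexpNeg_le hfinite hconst fun η hη => ?_)
    (le_of_forall_mul_eexpNeg_le (ENNReal.mul_ne_top (eexpNeg_ne_top _)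
      (poissonLaplace_ne_top lam _)) hconst fun η hη => ?_) <;>
    obtain ⟨r, hr, hball⟩ := hR η hη
  · exact h.laplaceFunctional_mul_eexpNeg_le hΦ hlam measurableSet_ball
      (Metric.measure_ball_pos volume 0 hr).ne' measure_ball_lt_top.ne hwm
      measurableSet_closedBall (fun x hx y => (hball x hx y).1) fun x hx y => (hball x hx y).2
  · exact h.mul_eexpNeg_le_laplaceFunctional hΦ hlam measurableSet_ball
      (Metric.measure_ball_pos volume 0 hr).ne' measure_ball_lt_top.ne hwm
      measurableSet_closedBall (fun x hx y => (hball x hx y).1) fun x hx y => (hball x hx y).2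

/-- Slivnyak's theorem for Laplace functionals. -/
theorem laplaceFunctional_reduced [IsProbabilityMeasure P] (h : IsPalmVersion lam Φ P₀ X P)
    (hΦ : IsHomogeneousPPP lam Φ P₀) (hlam : 0 < lam) {w : Plane → ℝ≥0} (hw : Continuous w) :
    laplaceFunctional (fun n => X (n + 1)) P (fun y => w y) =
      poissonLaplace lam fun y => w y := by
  obtain ⟨f, hf, hfc, hmono, hlim⟩ := exists_monotone_hasCompactSupport_tendsto hw
  have hfm (k : ℕ) : Measurable fun y => (f k y : ℝ≥0∞) := (hf k).measurable.coe_nnreal_ennreal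
  have hcompact (k : ℕ) : laplaceFunctional (fun n => X (n + 1)) P (fun y => f k y) =
      poissonLaplace lam fun y => f k y :=
    (ENNReal.mul_right_inj (eexpNeg_ne_zero ENNReal.coe_ne_top) (eexpNeg_ne_top _)).1 <|
      (h.laplaceFunctional_eq_mul (hfm k)).symm.trans
        (h.laplaceFunctional_of_hasCompactSupport hΦ hlam (hf k) (hfc k))
  have hmono' : Monotone fun k y => (f k y : ℝ≥0∞) :=
    fun k m hkm y => ENNReal.coe_le_coe.2 (hmono hkm y)
  have hlim' (y : Plane) := ENNReal.tendsto_coe.2 (hlim y)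
  have hX := tendsto_laplaceFunctional (P := P) (fun n => h.measurable (n + 1)) hfm hmono' hlim'
  simp_rw [hcompact] at hX
  exact tendsto_nhds_unique hX (tendsto_poissonLaplace lam hfm hmono' hlim')

end IsPalmVersion

/-! ### Independent clusters -/

section Clusters

variable {Ω : Type*} [MeasurableSpace Ω] {P : Measure Ω}

variable {ι E U : Type*} [MeasurableSpace E] [MeasurableSpace U]
  {X : ι → Ω → E} {S : ι → Ω → ℕ} {M : ι × ℕ → Ω → U}
  {sizeLaw : Measure ℕ} {markLaw : Measure U}

lemma lintegral_prod_prod_range (hM : ∀ i, Measurable (M i))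
    (hMlaw : ∀ i, HasLaw (M i) markLaw P) (hMi : iIndepFun M P) {f : ι → U → ℝ≥0∞}
    (hf : ∀ n, Measurable (f n)) (T : Finset ι) (k : ι → ℕ) :
    ∫⁻ ω, ∏ n ∈ T, ∏ j ∈ Finset.range (k n), f n (M (n, j) ω) ∂P =
      ∏ n ∈ T, (∫⁻ m, f n m ∂markLaw) ^ k n := by
  let r : Finset (ι × ℕ) :=
    (T.sigma fun n => Finset.range (k n)).map (Equiv.sigmaEquivProd ι ℕ).toEmbedding
  have hr (q : ι × ℕ) : q ∈ r ↔ q.1 ∈ T ∧ q.2 ∈ Finset.range (k q.1) := by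
    obtain ⟨n, j⟩ := q
    simp [r]
  have hflat (F : ι → ℕ → ℝ≥0∞) :
      ∏ n ∈ T, ∏ j ∈ Finset.range (k n), F n j = ∏ q ∈ r, F q.1 q.2 :=
    (Finset.prod_finset_product r T _ hr (f := fun q => F q.1 q.2)).symm
  have hmean (q : ι × ℕ) : ∫⁻ ω, f q.1 (M q ω) ∂P = ∫⁻ m, f q.1 m ∂markLaw :=
    (hMlaw q).lintegral_comp (hf _).aemeasurable
  calc ∫⁻ ω, ∏ n ∈ T, ∏ j ∈ Finset.range (k n), f n (M (n, j) ω) ∂P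
      = ∫⁻ ω, ∏ q ∈ r, f q.1 (M q ω) ∂P :=
        lintegral_congr fun ω => hflat fun n j => f n (M (n, j) ω)
    _ = ∏ q ∈ r, ∫⁻ ω, f q.1 (M q ω) ∂P :=
        lintegral_prod_eq_prod_lintegral_of_indepFun r _
          (hMi.comp (fun q => f q.1) fun q => hf _) fun q => (hf _).comp (hM q)
    _ = ∏ n ∈ T, ∏ _j ∈ Finset.range (k n), ∫⁻ m, f n m ∂markLaw := by
        simp only [hmean, hflat]
    _ = ∏ n ∈ T, (∫⁻ m, f n m ∂markLaw) ^ k n := by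
        simp only [Finset.prod_const, Finset.card_range]

lemma measurable_prod_prod_range {α : Type*} [MeasurableSpace α] {k : ι → α → ℕ}
    (hk : ∀ n, Measurable (k n)) {f : ι → ℕ → α → ℝ≥0∞} (hf : ∀ n j, Measurable (f n j))
    (T : Finset ι) : Measurable fun a => ∏ n ∈ T, ∏ j ∈ Finset.range (k n a), f n j a := by
  refine Finset.measurable_prod _ fun n _ => ?_
  have hprod : Measurable fun q : ℕ × α => ∏ j ∈ Finset.range q.1, f n j q.2 :=
    measurable_from_prod_countable_right fun m =>
      Finset.measurable_prod (Finset.range m) fun j _ => hf n j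
  exact hprod.comp ((hk n).prodMk measurable_id)

variable [IsProbabilityMeasure P]

lemma lintegral_comp_of_indepFun {α β : Type*} [MeasurableSpace α] [MeasurableSpace β]
    {A : Ω → α} {B : Ω → β} (h : IndepFun A B P) (hA : Measurable A) (hB : Measurable B)
    {F : α × β → ℝ≥0∞} (hF : Measurable F) :
    ∫⁻ ω, F (A ω, B ω) ∂P = ∫⁻ ω, ∫⁻ ω', F (A ω, B ω') ∂P ∂P := by
  have := Measure.isProbabilityMeasure_map (μ := P) hB.aemeasurable
  rw [← lintegral_map (f := F) (g := fun ω => (A ω, B ω)) hF (hA.prodMk hB),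
    (indepFun_iff_map_prod_eq_prod_map_map hA.aemeasurable hB.aemeasurable).1 h,
    lintegral_prod _ hF.aemeasurable, lintegral_map hF.lintegral_prod_right' hA]
  exact lintegral_congr fun ω => lintegral_map (hF.comp measurable_prodMk_left) hB

lemma lintegral_prod_prod_range_random (hS : ∀ n, Measurable (S n)) (hM : ∀ i, Measurable (M i))
    (hSlaw : ∀ n, HasLaw (S n) sizeLaw P) (hMlaw : ∀ i, HasLaw (M i) markLaw P)
    (hSi : iIndepFun S P) (hMi : iIndepFun M P)
    (hSM : IndepFun (fun ω n => S n ω) (fun ω i => M i ω) P) {f : ι → U → ℝ≥0∞}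
    (hf : ∀ n, Measurable (f n)) (T : Finset ι) :
    ∫⁻ ω, ∏ n ∈ T, ∏ j ∈ Finset.range (S n ω), f n (M (n, j) ω) ∂P =
      ∏ n ∈ T, ∫⁻ k, (∫⁻ m, f n m ∂markLaw) ^ k ∂sizeLaw := by
  have hF : Measurable fun a : (ι → ℕ) × (ι × ℕ → U) =>
      ∏ n ∈ T, ∏ j ∈ Finset.range (a.1 n), f n (a.2 (n, j)) :=
    measurable_prod_prod_range (fun n => by fun_prop) (fun n j => (hf n).comp (by fun_prop)) T
  calc ∫⁻ ω, ∏ n ∈ T, ∏ j ∈ Finset.range (S n ω), f n (M (n, j) ω) ∂P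
      = ∫⁻ ω, ∫⁻ ω', ∏ n ∈ T, ∏ j ∈ Finset.range (S n ω), f n (M (n, j) ω') ∂P ∂P :=
        lintegral_comp_of_indepFun hSM (measurable_pi_lambda _ hS) (measurable_pi_lambda _ hM) hF
    _ = ∫⁻ ω, ∏ n ∈ T, (∫⁻ m, f n m ∂markLaw) ^ S n ω ∂P :=
        lintegral_congr fun ω => lintegral_prod_prod_range hM hMlaw hMi hf T fun n => S n ω
    _ = ∏ n ∈ T, ∫⁻ ω, (∫⁻ m, f n m ∂markLaw) ^ S n ω ∂P :=
        lintegral_prod_eq_prod_lintegral_of_indepFun T _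
          (hSi.comp (fun n k => (∫⁻ m, f n m ∂markLaw) ^ k) fun n => .of_discrete)
          fun n => Measurable.of_discrete.comp (hS n)
    _ = ∏ n ∈ T, ∫⁻ k, (∫⁻ m, f n m ∂markLaw) ^ k ∂sizeLaw :=
        Finset.prod_congr rfl fun n _ => (hSlaw n).lintegral_comp
          (f := fun k => (∫⁻ m, f n m ∂markLaw) ^ k) Measurable.of_discrete.aemeasurable

lemma lintegral_prod_clusters (hX : ∀ n, Measurable (X n)) (hS : ∀ n, Measurable (S n))
    (hM : ∀ i, Measurable (M i)) (hSlaw : ∀ n, HasLaw (S n) sizeLaw P)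
    (hMlaw : ∀ i, HasLaw (M i) markLaw P) (hSi : iIndepFun S P) (hMi : iIndepFun M P)
    (hSM : IndepFun (fun ω n => S n ω) (fun ω i => M i ω) P)
    (hXSM : IndepFun (fun ω n => X n ω) (fun ω => (fun n => S n ω, fun i => M i ω)) P)
    {ξ : E → U → ℝ≥0∞} (hξ : Measurable (Function.uncurry ξ)) (T : Finset ι) :
    ∫⁻ ω, ∏ n ∈ T, ∏ k ∈ Finset.range (S n ω), ξ (X n ω) (M (n, k) ω) ∂P =
      ∫⁻ ω, ∏ n ∈ T, ∫⁻ k, (∫⁻ m, ξ (X n ω) m ∂markLaw) ^ k ∂sizeLaw ∂P := by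
  have hF : Measurable fun a : (ι → E) × (ι → ℕ) × (ι × ℕ → U) =>
      ∏ n ∈ T, ∏ k ∈ Finset.range (a.2.1 n), ξ (a.1 n) (a.2.2 (n, k)) :=
    measurable_prod_prod_range (fun n => by fun_prop) (fun n k => hξ.comp
      (f := fun a : (ι → E) × (ι → ℕ) × (ι × ℕ → U) => (a.1 n, a.2.2 (n, k))) (by fun_prop)) T
  refine (lintegral_comp_of_indepFun hXSM (measurable_pi_lambda _ hX)
    ((measurable_pi_lambda _ hS).prodMk (measurable_pi_lambda _ hM)) hF).trans
    (lintegral_congr fun ω => ?_)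
  exact lintegral_prod_prod_range_random hS hM hSlaw hMlaw hSi hMi hSM
    (fun n => hξ.comp measurable_prodMk_left) T

lemma tendsto_lintegral_eexpNeg_sum_range {f : ℕ → Ω → ℝ≥0∞} (hf : ∀ n, Measurable (f n)) :
    Tendsto (fun m => ∫⁻ ω, eexpNeg (∑ n ∈ Finset.range m, f n ω) ∂P) atTop
      (𝓝 (∫⁻ ω, eexpNeg (∑' n, f n ω) ∂P)) :=
  tendsto_lintegral_of_dominated_convergence (fun _ => 1)
    (fun m => measurable_eexpNeg.comp (Finset.measurable_sum _ fun n _ => hf n))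
    (fun n => .of_forall fun _ => eexpNeg_le_one _) (by simp)
    (.of_forall fun ω => (continuous_eexpNeg.tendsto _).comp (ENNReal.tendsto_nat_tsum _))

end Clusters

/-! ### The channel of a link -/

lemma lintegral_eexpNeg_gammaMeasure {a r t : ℝ} (ha : 0 < a) (hr : 0 < r) (ht : 0 ≤ t) :
    ∫⁻ x, eexpNeg (ENNReal.ofReal (t * x)) ∂gammaMeasure a r =
      ENNReal.ofReal ((1 + t / r) ^ (-a)) := by
  have hpdf (b : ℝ) : Measurable (gammaPDF a b) := (measurable_gammaPDFReal a b).ennreal_ofReal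
  have hscale : (1 + t / r) ^ (-a) * (r + t) ^ a = r ^ a := by
    rw [show r + t = r * (1 + t / r) by field_simp, Real.mul_rpow hr.le (by positivity),
      mul_left_comm, ← Real.rpow_add (by positivity), neg_add_cancel, Real.rpow_zero, mul_one]
  have htilt (x : ℝ) : gammaPDF a r x * eexpNeg (ENNReal.ofReal (t * x)) =
      ENNReal.ofReal ((1 + t / r) ^ (-a)) * gammaPDF a (r + t) x := by
    rcases lt_or_ge x 0 with hx | hx
    · simp [gammaPDF_of_neg hx]
    · rw [gammaPDF_of_nonneg hx, gammaPDF_of_nonneg hx, eexpNeg_ofReal (by positivity),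
        ← ENNReal.ofReal_mul (by positivity), ← ENNReal.ofReal_mul (by positivity), ← hscale,
        show -((r + t) * x) = -(r * x) + -(t * x) by ring, Real.exp_add]
      congr 1
      ring
  rw [gammaMeasure, lintegral_withDensity_eq_lintegral_mul _ (hpdf r) (by fun_prop)]
  simp only [Pi.mul_apply, htilt]
  rw [lintegral_const_mul _ (hpdf _), lintegral_gammaPDF_eq_one ha (by positivity), mul_one]

lemma setLIntegral_Icc_ite_lt {q : ℝ} (hq : q ∈ Icc (0 : ℝ) 1) (a b : ℝ≥0∞) :
    ∫⁻ u in Icc (0 : ℝ) 1, (if u < q then a else b) =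
      ENNReal.ofReal q * a + ENNReal.ofReal (1 - q) * b := by
  have hsplit (u : ℝ) : (if u < q then a else b) =
      (Iio q).indicator (fun _ => a) u + (Ici q).indicator (fun _ => b) u := by
    by_cases hu : u < q
    · simp [hu]
    · simp [hu, not_lt.1 hu]
  have hlow : Iio q ∩ Icc (0 : ℝ) 1 = Ico 0 q := by
    ext u
    simp only [mem_inter_iff, mem_Iio, mem_Icc, mem_Ico]
    exact ⟨fun h => ⟨h.2.1, h.1⟩, fun h => ⟨h.2, h.1, (h.2.trans_le hq.2).le⟩⟩
  have hhigh : Ici q ∩ Icc (0 : ℝ) 1 = Icc q 1 := by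
    ext u
    simp only [mem_inter_iff, mem_Ici, mem_Icc]
    exact ⟨fun h => ⟨h.1, h.2.2⟩, fun h => ⟨h.1, hq.1.trans h.1, h.2⟩⟩
  simp_rw [hsplit]
  rw [lintegral_add_left (measurable_const.indicator measurableSet_Iio),
    lintegral_indicator_const measurableSet_Iio, lintegral_indicator_const measurableSet_Ici,
    Measure.restrict_apply measurableSet_Iio, Measure.restrict_apply measurableSet_Ici,
    hlow, hhigh, Real.volume_Ico, Real.volume_Icc, sub_zero, mul_comm a, mul_comm b]

namespace UplinkParams

variable (p : UplinkParams)

lemma probLos_mem (k : ℕ) : p.probLos k ∈ Icc (0 : ℝ) 1 := by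
  have hfactor (x y : ℝ) : 1 - Real.exp (-(x ^ 2 / (2 * p.ε ^ 2 * y ^ 2))) ∈ Icc (0 : ℝ) 1 :=
    ⟨sub_nonneg.2 (Real.exp_le_one_iff.2 (neg_nonpos.2 (by positivity))),
      sub_le_self _ (Real.exp_nonneg _)⟩
  unfold probLos
  split_ifs
  · simp
  · exact ⟨Finset.prod_nonneg fun n _ => (hfactor _ _).1,
      Finset.prod_le_one (fun n _ => (hfactor _ _).1) fun n _ => (hfactor _ _).2⟩

lemma prob_nonneg (κ : LinkState) (k : ℕ) : 0 ≤ p.prob κ k := by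
  cases κ
  · exact (p.probLos_mem k).1
  · exact sub_nonneg.2 (p.probLos_mem k).2

lemma sum_gainProb : ∑ i, p.gainProb i = 1 := by
  simp only [Fin.sum_univ_four, gainProb, Matrix.cons_val]
  ring

/-- The conditional Laplace transform at `s` of the channel gain of a link at horizontal distance
`r`, given that its state is `κ`; thus `Λ^κ = p_κ * stateLaplace κ`. -/
noncomputable def stateLaplace (κ : LinkState) (s r : ℝ) : ℝ :=
  ∑ i : Fin 4, p.gainProb i * (1 + s * p.C κ * p.gainValue i
    / (p.nak κ * Real.sqrt ((r ^ 2 + p.Δh ^ 2) ^ p.α κ))) ^ (-p.nak κ)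

/-- `Λ^L + Λ^N` at distance `r`: the Laplace transform at `s` of the channel gain of a link. -/
noncomputable def linkLaplace (s r : ℝ) : ℝ :=
  p.Λ .los (p.γ r) r s + p.Λ .nlos (p.γ r) r s

/-- The law of the channel variables of a user: all of `userLaw` except the displacement. -/
noncomputable def channelLaw : Measure (ℝ × ℝ × ℝ × ℝ) :=
  (volume.restrict (Icc (0 : ℝ) 1)).prod ((gammaMeasure (p.nak .los) (p.nak .los)).prod
    ((gammaMeasure (p.nak .nlos) (p.nak .nlos)).prod p.gainLaw))

/-- The channel gain at horizontal distance `r` as a function of the channel variables, which are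
listed as in `channelLaw`: blockage, line-of-sight fading, non-line-of-sight fading, directivity
gain. -/
noncomputable def linkGain (r : ℝ) (c : ℝ × ℝ × ℝ × ℝ) : ℝ :=
  if c.1 < p.prob .los (p.γ r) then p.pathLoss .los r * c.2.2.2 * c.2.1
  else p.pathLoss .nlos r * c.2.2.2 * c.2.2.1

@[fun_prop]
lemma measurable_pathLoss (κ : LinkState) : Measurable (p.pathLoss κ) := by
  unfold pathLoss
  fun_prop

@[fun_prop]
lemma measurable_prob_γ (κ : LinkState) : Measurable fun r => p.prob κ (p.γ r) :=
  (Measurable.of_discrete (f := p.prob κ)).comp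
    (Nat.measurable_floor.comp (measurable_id.mul_const _))

@[fun_prop]
lemma measurable_linkGain : Measurable (Function.uncurry p.linkGain) := by
  have hprob : Measurable fun a : ℝ × ℝ × ℝ × ℝ × ℝ => p.prob .los (p.γ a.1) :=
    (p.measurable_prob_γ .los).comp measurable_fst
  exact Measurable.ite (measurableSet_lt (by fun_prop) hprob) (by fun_prop) (by fun_prop)

lemma measurable_eexpNeg_linkGain (s r : ℝ) :
    Measurable fun c => eexpNeg (ENNReal.ofReal s * ENNReal.ofReal (p.linkGain r c)) :=
  measurable_eexpNeg.comp
    ((p.measurable_linkGain.comp measurable_prodMk_left).ennreal_ofReal.const_mul _)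

@[fun_prop]
lemma measurable_linkLaplace (s : ℝ) : Measurable (p.linkLaplace s) := by
  have hΛ (κ : LinkState) : Measurable fun r => p.Λ κ (p.γ r) r s :=
    (p.measurable_prob_γ κ).mul (by fun_prop)
  exact (hΛ .los).add (hΛ .nlos)

namespace Admissible

variable {p} (hp : p.Admissible)
include hp

lemma gainProb_nonneg (i : Fin 4) : 0 ≤ p.gainProb i := by
  have hfraction {x y : ℝ} (hx : x ∈ Icc 0 (2 * Real.pi)) (hy : y ∈ Icc 0 Real.pi) :
      x / (2 * Real.pi) * (y / Real.pi) ∈ Icc (0 : ℝ) 1 := by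
    have hx' := div_nonneg hx.1 Real.two_pi_pos.le
    have hy' := div_nonneg hy.1 Real.pi_pos.le
    exact ⟨mul_nonneg hx' hy', mul_le_one₀ ((div_le_one Real.two_pi_pos).2 hx.2) hy'
      ((div_le_one Real.pi_pos).2 hy.2)⟩
  obtain ⟨ha0, ha1⟩ := hfraction hp.θta_mem hp.θte_mem
  obtain ⟨hb0, hb1⟩ := hfraction hp.θra_mem hp.θre_mem
  fin_cases i
  · exact mul_nonneg ha0 hb0
  · exact mul_nonneg (sub_nonneg.2 ha1) hb0
  · exact mul_nonneg ha0 (sub_nonneg.2 hb1)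
  · exact mul_nonneg (sub_nonneg.2 ha1) (sub_nonneg.2 hb1)

lemma gainValue_nonneg (i : Fin 4) : 0 ≤ p.gainValue i := by
  fin_cases i
  · exact mul_nonneg hp.Mt_nonneg hp.Mr_nonneg
  · exact mul_nonneg hp.mt_nonneg hp.Mr_nonneg
  · exact mul_nonneg hp.Mt_nonneg hp.mr_nonneg
  · exact mul_nonneg hp.mt_nonneg hp.mr_nonneg

lemma pathLoss_nonneg (κ : LinkState) (r : ℝ) : 0 ≤ p.pathLoss κ r :=
  div_nonneg (hp.C_pos κ).le (Real.sqrt_nonneg _)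

lemma isProbabilityMeasure_gainLaw : IsProbabilityMeasure p.gainLaw := by
  constructor
  simp only [gainLaw, Measure.finsetSum_apply, Measure.smul_apply, measure_univ, smul_eq_mul,
    mul_one]
  rw [← ENNReal.ofReal_sum_of_nonneg fun i _ => hp.gainProb_nonneg i, sum_gainProb,
    ENNReal.ofReal_one]

lemma isProbabilityMeasure_fading (κ : LinkState) :
    IsProbabilityMeasure (gammaMeasure (p.nak κ) (p.nak κ)) :=
  isProbabilityMeasure_gammaMeasure (hp.nak_pos κ) (hp.nak_pos κ)

lemma isProbabilityMeasure_channelLaw : IsProbabilityMeasure p.channelLaw := by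
  have := hp.isProbabilityMeasure_gainLaw
  have := hp.isProbabilityMeasure_fading
  have : IsProbabilityMeasure (volume.restrict (Icc (0 : ℝ) 1)) := ⟨by simp⟩
  unfold channelLaw
  infer_instance

variable {s : ℝ} (hs : 0 ≤ s)
include hs

lemma stateLaplace_summand_nonneg (κ : LinkState) (r : ℝ) (i : Fin 4) :
    0 ≤ p.gainProb i * (1 + s * p.C κ * p.gainValue i
      / (p.nak κ * Real.sqrt ((r ^ 2 + p.Δh ^ 2) ^ p.α κ))) ^ (-p.nak κ) := by
  have := hp.gainProb_nonneg i
  have := hp.gainValue_nonneg i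
  have := hp.C_pos κ
  have := hp.nak_pos κ
  positivity

lemma stateLaplace_nonneg (κ : LinkState) (r : ℝ) : 0 ≤ p.stateLaplace κ s r :=
  Finset.sum_nonneg fun i _ => hp.stateLaplace_summand_nonneg hs κ r i

lemma Λ_nonneg (κ : LinkState) (k : ℕ) (r : ℝ) : 0 ≤ p.Λ κ k r s :=
  mul_nonneg (p.prob_nonneg κ k) (hp.stateLaplace_nonneg hs κ r)

lemma linkLaplace_nonneg (r : ℝ) : 0 ≤ p.linkLaplace s r :=
  add_nonneg (hp.Λ_nonneg hs _ _ _) (hp.Λ_nonneg hs _ _ _)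

lemma lintegral_eexpNeg_fading (κ : LinkState) (r : ℝ) (i : Fin 4) :
    ∫⁻ f, eexpNeg (ENNReal.ofReal s * ENNReal.ofReal (p.pathLoss κ r * p.gainValue i * f))
        ∂gammaMeasure (p.nak κ) (p.nak κ) =
      ENNReal.ofReal ((1 + s * p.C κ * p.gainValue i
        / (p.nak κ * Real.sqrt ((r ^ 2 + p.Δh ^ 2) ^ p.α κ))) ^ (-p.nak κ)) := by
  have hassoc (f : ℝ) :
      ENNReal.ofReal s * ENNReal.ofReal (p.pathLoss κ r * p.gainValue i * f) =
        ENNReal.ofReal (s * (p.pathLoss κ r * p.gainValue i) * f) := by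
    rw [← ENNReal.ofReal_mul hs, mul_assoc s]
  simp_rw [hassoc]
  rw [lintegral_eexpNeg_gammaMeasure (hp.nak_pos κ) (hp.nak_pos κ)
    (mul_nonneg hs (mul_nonneg (hp.pathLoss_nonneg κ r) (hp.gainValue_nonneg i))), pathLoss]
  congr 3
  ring

lemma lintegral_eexpNeg_fading_gain (κ : LinkState) (r : ℝ) :
    ∫⁻ c : ℝ × ℝ, eexpNeg (ENNReal.ofReal s * ENNReal.ofReal (p.pathLoss κ r * c.2 * c.1))
        ∂(gammaMeasure (p.nak κ) (p.nak κ)).prod p.gainLaw =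
      ENNReal.ofReal (p.stateLaplace κ s r) := by
  have := hp.isProbabilityMeasure_gainLaw
  have hgain (f : ℝ) :
      ∫⁻ g, eexpNeg (ENNReal.ofReal s * ENNReal.ofReal (p.pathLoss κ r * g * f)) ∂p.gainLaw =
        ∑ i : Fin 4, ENNReal.ofReal (p.gainProb i) *
          eexpNeg (ENNReal.ofReal s * ENNReal.ofReal (p.pathLoss κ r * p.gainValue i * f)) := by
    simp only [gainLaw, lintegral_finsetSum_measure, lintegral_smul_measure, smul_eq_mul,
      lintegral_dirac]
  rw [lintegral_prod _ (by fun_prop), stateLaplace, ENNReal.ofReal_sum_of_nonneg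
    fun i _ => hp.stateLaplace_summand_nonneg hs κ r i]
  simp_rw [hgain]
  rw [lintegral_finsetSum _ fun i _ => by fun_prop]
  refine Finset.sum_congr rfl fun i _ => ?_
  rw [lintegral_const_mul _ (by fun_prop), ENNReal.ofReal_mul (hp.gainProb_nonneg i),
    hp.lintegral_eexpNeg_fading hs]

lemma lintegral_eexpNeg_linkGain_of_block (r b : ℝ) :
    ∫⁻ c : ℝ × ℝ × ℝ, eexpNeg (ENNReal.ofReal s * ENNReal.ofReal (p.linkGain r (b, c)))
        ∂(gammaMeasure (p.nak .los) (p.nak .los)).prod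
          ((gammaMeasure (p.nak .nlos) (p.nak .nlos)).prod p.gainLaw) =
      if b < p.prob .los (p.γ r) then ENNReal.ofReal (p.stateLaplace .los s r)
      else ENNReal.ofReal (p.stateLaplace .nlos s r) := by
  have := hp.isProbabilityMeasure_gainLaw
  have := hp.isProbabilityMeasure_fading
  have hlos : MeasurePreserving (fun c : ℝ × ℝ × ℝ => (c.1, c.2.2))
      ((gammaMeasure (p.nak .los) (p.nak .los)).prod
        ((gammaMeasure (p.nak .nlos) (p.nak .nlos)).prod p.gainLaw))
      ((gammaMeasure (p.nak .los) (p.nak .los)).prod p.gainLaw) :=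
    (MeasurePreserving.id _).prod measurePreserving_snd
  have hnlos : MeasurePreserving Prod.snd
      ((gammaMeasure (p.nak .los) (p.nak .los)).prod
        ((gammaMeasure (p.nak .nlos) (p.nak .nlos)).prod p.gainLaw))
      ((gammaMeasure (p.nak .nlos) (p.nak .nlos)).prod p.gainLaw) :=
    measurePreserving_snd
  unfold linkGain
  split_ifs
  · rw [← hp.lintegral_eexpNeg_fading_gain hs, ← hlos.lintegral_comp (by fun_prop)]
  · rw [← hp.lintegral_eexpNeg_fading_gain hs, ← hnlos.lintegral_comp (by fun_prop)]

lemma lintegral_eexpNeg_linkGain (r : ℝ) :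
    ∫⁻ c, eexpNeg (ENNReal.ofReal s * ENNReal.ofReal (p.linkGain r c)) ∂p.channelLaw =
      ENNReal.ofReal (p.linkLaplace s r) := by
  have := hp.isProbabilityMeasure_gainLaw
  have := hp.isProbabilityMeasure_fading
  rw [channelLaw, lintegral_prod _ (p.measurable_eexpNeg_linkGain s r).aemeasurable]
  simp_rw [hp.lintegral_eexpNeg_linkGain_of_block hs]
  rw [setLIntegral_Icc_ite_lt (q := p.prob .los (p.γ r)) (p.probLos_mem _)]
  change ENNReal.ofReal (p.prob .los _) * _ + ENNReal.ofReal (p.prob .nlos _) * _ = _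
  rw [← ENNReal.ofReal_mul (p.prob_nonneg .los _), ← ENNReal.ofReal_mul (p.prob_nonneg .nlos _)]
  exact (ENNReal.ofReal_add (hp.Λ_nonneg hs .los _ _) (hp.Λ_nonneg hs .nlos _ _)).symm

lemma linkLaplace_le_one (r : ℝ) : p.linkLaplace s r ≤ 1 := by
  have := hp.isProbabilityMeasure_channelLaw
  rw [← ENNReal.ofReal_le_one, ← hp.lintegral_eexpNeg_linkGain hs r]
  exact (lintegral_mono fun _ => eexpNeg_le_one _).trans_eq (by simp)

lemma linkLaplace_pos (r : ℝ) : 0 < p.linkLaplace s r := by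
  have := hp.isProbabilityMeasure_channelLaw
  rw [← ENNReal.ofReal_pos, ← hp.lintegral_eexpNeg_linkGain hs r,
    lintegral_pos_iff_support (p.measurable_eexpNeg_linkGain s r)]
  have hsupport : Function.support (fun c => eexpNeg (ENNReal.ofReal s *
      ENNReal.ofReal (p.linkGain r c))) = univ :=
    eq_univ_of_forall fun c => eexpNeg_ne_zero
      (ENNReal.mul_ne_top ENNReal.ofReal_ne_top ENNReal.ofReal_ne_top)
  simp [hsupport]

end Admissible

end UplinkParams

/-! ### Cosine integrals and polar coordinates -/

lemma integral_cos_pow_odd_neg_pi_pi (k : ℕ) :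
    ∫ θ in -Real.pi..Real.pi, Real.cos θ ^ (2 * k + 1) = 0 := by
  induction k with
  | zero => simp
  | succ k ih => rw [show 2 * (k + 1) + 1 = 2 * k + 1 + 2 by ring, integral_cos_pow, ih]; simp

lemma integral_cos_pow_even_neg_pi_pi (k : ℕ) :
    ∫ θ in -Real.pi..Real.pi, Real.cos θ ^ (2 * k) =
      2 * Real.pi * ((2 * k)! / (4 ^ k * (k ! : ℝ) ^ 2)) := by
  induction k with
  | zero => simp [two_mul]
  | succ k ih =>
    rw [show 2 * (k + 1) = 2 * k + 2 by ring, integral_cos_pow, ih, Nat.factorial_succ (2 * k + 1),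
      Nat.factorial_succ (2 * k), Nat.factorial_succ k]
    push_cast
    rw [Real.sin_pi, Real.sin_neg, Real.sin_pi]
    field_simp
    ring

lemma hasSum_integral_exp_mul_cos (z : ℝ) :
    HasSum (fun n : ℕ => z ^ n / n ! * ∫ θ in -Real.pi..Real.pi, Real.cos θ ^ n)
      (∫ θ in -Real.pi..Real.pi, Real.exp (z * Real.cos θ)) := by
  have hterm (n : ℕ) : z ^ n / n ! * ∫ θ in -Real.pi..Real.pi, Real.cos θ ^ n =
      ∫ θ in -Real.pi..Real.pi, (z * Real.cos θ) ^ n / n ! := by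
    rw [← intervalIntegral.integral_const_mul]
    congr 1 with θ
    rw [mul_pow]
    ring
  simp_rw [hterm]
  refine intervalIntegral.hasSum_integral_of_dominated_convergence
    (fun n _ => |z| ^ n / n !) (fun n => by fun_prop) (fun n => .of_forall fun θ _ => ?_)
    (.of_forall fun θ _ => (NormedSpace.expSeries_div_hasSum_exp |z|).summable) (by simp)
    (.of_forall fun θ _ => ?_)
  · rw [norm_div, norm_pow, norm_mul, Real.norm_eq_abs, Real.norm_eq_abs, Real.norm_natCast]
    gcongr
    exact mul_le_of_le_one_right (abs_nonneg z) (Real.abs_cos_le_one θ)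
  · rw [Real.exp_eq_exp_ℝ]
    exact NormedSpace.expSeries_div_hasSum_exp (z * Real.cos θ)

lemma integral_exp_mul_cos (z : ℝ) :
    ∫ θ in -Real.pi..Real.pi, Real.exp (z * Real.cos θ) = 2 * Real.pi * besselI0 z := by
  have hsum := hasSum_integral_exp_mul_cos z
  have hinj : Function.Injective fun k : ℕ => 2 * k := fun a b h => by simpa using h
  rw [← hinj.hasSum_iff] at hsum
  · rw [← hsum.tsum_eq, besselI0, ← tsum_mul_left]
    refine tsum_congr fun k => ?_
    rw [Function.comp_apply, integral_cos_pow_even_neg_pi_pi, div_pow, pow_mul 2 2 k]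
    have : ((2 * k)! : ℝ) ≠ 0 := by positivity
    norm_num
    field_simp
  · intro n hn
    rcases Nat.even_or_odd' n with ⟨k, rfl | rfl⟩
    · exact absurd ⟨k, rfl⟩ hn
    · rw [integral_cos_pow_odd_neg_pi_pi, mul_zero]

lemma besselI0_nonneg (z : ℝ) : 0 ≤ besselI0 z :=
  tsum_nonneg fun k => div_nonneg (by rw [pow_mul]; positivity) (by positivity)

@[fun_prop]
lemma measurable_besselI0 : Measurable besselI0 :=
  Measurable.tsum fun k => by fun_prop

lemma volume_inter_setOf_le_cos (c : ℝ) :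
    volume ({θ | c ≤ Real.cos θ} ∩ Ioo (-Real.pi) Real.pi) =
      ENNReal.ofReal (2 * Real.arccos c) := by
  have harccos {θ : ℝ} (hθ : θ ∈ Ioo (-Real.pi) Real.pi) : Real.arccos (Real.cos θ) = |θ| := by
    rw [← Real.cos_abs, Real.arccos_cos (abs_nonneg θ) (abs_le.2 ⟨hθ.1.le, hθ.2.le⟩)]
  have hsubset : {θ | c ≤ Real.cos θ} ∩ Ioo (-Real.pi) Real.pi ⊆
      Icc (-Real.arccos c) (Real.arccos c) := fun θ hθ =>
    abs_le.1 (harccos hθ.2 ▸ Real.antitone_arccos hθ.1)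
  have hsuperset : Ioo (-Real.arccos c) (Real.arccos c) ⊆
      {θ | c ≤ Real.cos θ} ∩ Ioo (-Real.pi) Real.pi := fun θ hθ => by
    have hπ := Real.arccos_le_pi c
    have hmem : θ ∈ Ioo (-Real.pi) Real.pi := ⟨by linarith [hθ.1], by linarith [hθ.2]⟩
    refine ⟨le_of_not_ge (α := ℝ) fun hcos => (abs_lt.2 hθ).not_ge ?_, hmem⟩
    exact harccos hmem ▸ Real.antitone_arccos hcos
  have hlength : Real.arccos c - -Real.arccos c = 2 * Real.arccos c := by ring
  apply le_antisymm
  · exact (measure_mono hsubset).trans_eq (by rw [Real.volume_Icc, hlength])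
  · exact (by rw [Real.volume_Ioo, hlength] : _ = volume _).trans_le (measure_mono hsuperset)

/-- The distance between two points whose distances from the origin are `r` and `q` and which are
seen from the origin under the angle `θ`. -/
noncomputable def cosineDist (r q θ : ℝ) : ℝ :=
  Real.sqrt (r ^ 2 + q ^ 2 - 2 * r * q * Real.cos θ)

lemma sq_cosineDist (r q θ : ℝ) :
    cosineDist r q θ ^ 2 = r ^ 2 + q ^ 2 - 2 * r * q * Real.cos θ := by
  refine Real.sq_sqrt ?_
  nlinarith [sq_nonneg (r - q * Real.cos θ), sq_nonneg (q * Real.sin θ),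
    Real.sin_sq_add_cos_sq θ]

@[fun_prop]
lemma continuous_cosineDist (r q : ℝ) : Continuous (cosineDist r q) := by
  unfold cosineDist
  fun_prop

lemma norm_polarCoord_symm_sub (r q θ : ℝ) :
    ‖Complex.polarCoord.symm (r, θ) - (q : ℂ)‖ = cosineDist r q θ := by
  rw [Complex.norm_def, Complex.normSq_apply, Complex.polarCoord_symm_apply, cosineDist]
  congr 1
  simp only [Complex.sub_re, Complex.mul_re, Complex.add_re, Complex.sub_im, Complex.mul_im,
    Complex.add_im, Complex.ofReal_re, Complex.ofReal_im, Complex.I_re, Complex.I_im]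
  linear_combination r ^ 2 * Real.sin_sq_add_cos_sq θ

lemma lintegral_complex_polar {F : ℂ → ℝ≥0∞} (hF : Measurable F) :
    ∫⁻ z, F z = ∫⁻ r in Ioi (0 : ℝ), ENNReal.ofReal r * ∫⁻ θ in Ioo (-Real.pi) Real.pi,
      F (Complex.polarCoord.symm (r, θ)) := by
  have hpolar : Measurable fun a : ℝ × ℝ => F (Complex.polarCoord.symm a) := by
    simp_rw [Complex.polarCoord_symm_apply]
    fun_prop
  rw [← Complex.lintegral_comp_polarCoord_symm, polarCoord_target, Measure.volume_eq_prod,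
    ← Measure.prod_restrict]
  simp only [smul_eq_mul]
  refine (lintegral_prod _ (measurable_fst.ennreal_ofReal.mul hpolar).aemeasurable).trans ?_
  exact lintegral_congr fun r =>
    lintegral_const_mul (ENNReal.ofReal r) (hpolar.comp (measurable_prodMk_left (x := r)))

lemma exists_linearIsometryEquiv_complex_plane (x : Plane) :
    ∃ L : ℂ ≃ₗᵢ[ℝ] Plane, L (‖x‖ : ℂ) = x := by
  let e : ℂ ≃ₗᵢ[ℝ] Plane := Complex.orthonormalBasisOneI.repr
  refine ⟨(rotation (Circle.exp (e.symm x).arg)).trans e, ?_⟩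
  rw [LinearIsometryEquiv.trans_apply, rotation_apply, Circle.coe_exp, ← e.symm.norm_map x,
    mul_comm, Complex.norm_mul_exp_arg_mul_I, e.apply_symm_apply]

lemma lintegral_norm_norm_sub {F : ℝ → ℝ → ℝ≥0∞} (hF : Measurable (Function.uncurry F))
    (x : Plane) :
    ∫⁻ u : Plane, F ‖u‖ ‖u - x‖ = ∫⁻ r in Ioi (0 : ℝ), ENNReal.ofReal r *
      ∫⁻ θ in Ioo (-Real.pi) Real.pi, F r (cosineDist r ‖x‖ θ) := by
  obtain ⟨L, hL⟩ := exists_linearIsometryEquiv_complex_plane x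
  have hnorm (z : ℂ) : F ‖L z‖ ‖L z - x‖ = F ‖z‖ ‖z - ‖x‖‖ := by
    rw [← L.norm_map (z - ‖x‖), map_sub, hL, L.norm_map]
  rw [← L.measurePreserving.lintegral_comp_emb L.toHomeomorph.measurableEmbedding]
  simp_rw [hnorm]
  rw [lintegral_complex_polar (F := fun z => F ‖z‖ ‖z - ‖x‖‖)
    (hF.comp (measurable_norm.prodMk (measurable_id.sub_const _).norm))]
  refine setLIntegral_congr_fun measurableSet_Ioi fun r hr => ?_
  simp only [norm_polarCoord_symm_sub, Complex.norm_polarCoord_symm, abs_of_pos (mem_Ioi.1 hr)]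

lemma lintegral_plane_norm {h : ℝ → ℝ≥0∞} (hh : Measurable h) :
    ∫⁻ x : Plane, h ‖x‖ =
      ENNReal.ofReal (2 * Real.pi) * ∫⁻ r in Ioi (0 : ℝ), ENNReal.ofReal r * h r := by
  rw [lintegral_norm_norm_sub (F := fun r _ => h r) (hh.comp measurable_fst) 0,
    ← lintegral_const_mul _ (by fun_prop)]
  refine lintegral_congr fun r => ?_
  rw [setLIntegral_const, Real.volume_Ioo, sub_neg_eq_add, ← two_mul]
  ring

/-! ### The distance distribution -/

@[fun_prop]
lemma measurable_unitStep : Measurable unitStep :=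
  Measurable.ite measurableSet_Ici measurable_const measurable_const

lemma unitStep_of_nonneg {x : ℝ} (hx : 0 ≤ x) : unitStep x = 1 := if_pos hx

lemma unitStep_of_neg {x : ℝ} (hx : x < 0) : unitStep x = 0 := if_neg hx.not_ge

lemma unitStep_nonneg (x : ℝ) : 0 ≤ unitStep x := by
  unfold unitStep
  split_ifs <;> simp

namespace ClusterShape

/-- The density of the displacement of a user as a function of its length. -/
noncomputable def radialDensity (c : ClusterShape) (t : ℝ) : ℝ :=
  match c with
  | thomas σ => 1 / (2 * Real.pi * σ ^ 2) * Real.exp (-(t ^ 2 / (2 * σ ^ 2)))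
  | matern R => 1 / (Real.pi * R ^ 2) * unitStep (R - t)

lemma density_eq_radialDensity (c : ClusterShape) (u v : Plane) :
    c.density u v = c.radialDensity ‖u - v‖ := by
  cases c <;> rfl

@[fun_prop]
lemma measurable_radialDensity (c : ClusterShape) : Measurable c.radialDensity := by
  cases c <;> unfold radialDensity <;> fun_prop

lemma radialDensity_nonneg (c : ClusterShape) (t : ℝ) : 0 ≤ c.radialDensity t := by
  cases c with
  | thomas σ => exact mul_nonneg (by positivity) (Real.exp_nonneg _)
  | matern R => exact mul_nonneg (by positivity) (unitStep_nonneg _)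

lemma ofReal_radialDensity_matern {R : ℝ} (t : ℝ) :
    ENNReal.ofReal ((matern R).radialDensity t) =
      (Iic R).indicator (fun _ => ENNReal.ofReal (1 / (Real.pi * R ^ 2))) t := by
  rcases le_or_gt t R with ht | ht
  · rw [radialDensity, unitStep_of_nonneg (sub_nonneg.2 ht), mul_one,
      indicator_of_mem (mem_Iic.2 ht)]
  · rw [radialDensity, unitStep_of_neg (sub_neg.2 ht), mul_zero, ENNReal.ofReal_zero,
      indicator_of_notMem (notMem_Iic.2 ht)]

@[fun_prop]
lemma measurable_distDensity (c : ClusterShape) (q : ℝ) :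
    Measurable fun g => c.distDensity g q := by
  cases c <;> unfold distDensity <;> fun_prop

lemma distDensity_nonneg (c : ClusterShape) {g : ℝ} (hg : 0 ≤ g) (q : ℝ) :
    0 ≤ c.distDensity g q := by
  cases c with
  | thomas σ => exact mul_nonneg (by positivity) (besselI0_nonneg _)
  | matern R =>
    exact add_nonneg (mul_nonneg (mul_nonneg (mul_nonneg (by positivity) (Real.arccos_nonneg _))
      (unitStep_nonneg _)) (unitStep_nonneg _)) (mul_nonneg (by positivity) (unitStep_nonneg _))

lemma distDensity_matern {R q r : ℝ} (hR : 0 < R) (hq : 0 < q) (hr : 0 < r) (hne : r ≠ |R - q|) :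
    (matern R).distDensity r q =
      2 * r / (Real.pi * R ^ 2) * Real.arccos ((r ^ 2 + q ^ 2 - R ^ 2) / (2 * r * q)) := by
  have hdisjoint (h : R ^ 2 ≤ (r - q) ^ 2) :
      Real.arccos ((r ^ 2 + q ^ 2 - R ^ 2) / (2 * r * q)) = 0 := by
    rw [Real.arccos_eq_zero, one_le_div (by positivity)]
    linarith
  have habs := le_abs_self (R - q)
  rw [distDensity]
  rcases lt_or_gt_of_ne hne with hlt | hlt
  · rw [unitStep_of_neg (sub_neg.2 hlt)]
    rcases le_total q R with hqR | hqR
    · rw [abs_of_nonneg (sub_nonneg.2 hqR)] at hlt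
      have hcontained : Real.arccos ((r ^ 2 + q ^ 2 - R ^ 2) / (2 * r * q)) = Real.pi := by
        rw [Real.arccos_eq_pi, div_le_iff₀ (by positivity)]
        nlinarith
      rw [hcontained, unitStep_of_nonneg (sub_nonneg.2 hlt.le)]
      field_simp
      ring
    · rw [abs_of_nonpos (sub_nonpos.2 hqR)] at hlt
      rw [hdisjoint (by nlinarith), unitStep_of_neg (x := R - q - r) (by linarith)]
      ring
  · rw [unitStep_of_neg (x := R - q - r) (by linarith), unitStep_of_nonneg (sub_nonneg.2 hlt.le)]
    rcases le_or_gt r (R + q) with hle | hgt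
    · rw [unitStep_of_nonneg (sub_nonneg.2 hle)]
      ring
    · rw [hdisjoint (by nlinarith), unitStep_of_neg (sub_neg.2 hgt)]
      ring

lemma lintegral_radialDensity_thomas {σ : ℝ} (hσ : 0 < σ) {r : ℝ} (hr : 0 < r) (q : ℝ) :
    ENNReal.ofReal r * ∫⁻ θ in Ioo (-Real.pi) Real.pi,
        ENNReal.ofReal ((thomas σ).radialDensity (cosineDist r q θ)) =
      ENNReal.ofReal ((thomas σ).distDensity r q) := by
  have hexpand (θ : ℝ) : (thomas σ).radialDensity (cosineDist r q θ) =
      1 / (2 * Real.pi * σ ^ 2) * Real.exp (-((r ^ 2 + q ^ 2) / (2 * σ ^ 2))) *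
        Real.exp (r * q / σ ^ 2 * Real.cos θ) := by
    rw [radialDensity, sq_cosineDist, mul_assoc _ (Real.exp _), ← Real.exp_add]
    congr 2
    field_simp
    ring
  have hint : IntegrableOn (fun θ => (thomas σ).radialDensity (cosineDist r q θ))
      (Ioo (-Real.pi) Real.pi) := by
    have hcont : Continuous fun θ => (thomas σ).radialDensity (cosineDist r q θ) := by
      simp_rw [hexpand]
      fun_prop
    exact hcont.integrableOn_Icc.mono_set Ioo_subset_Icc_self
  rw [← ofReal_integral_eq_lintegral_ofReal hint (.of_forall fun θ => radialDensity_nonneg _ _)]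
  simp_rw [hexpand]
  rw [integral_const_mul, ← integral_Ioc_eq_integral_Ioo,
    ← intervalIntegral.integral_of_le (neg_le_self Real.pi_nonneg), integral_exp_mul_cos,
    ← ENNReal.ofReal_mul hr.le, distDensity]
  congr 1
  field_simp

lemma lintegral_radialDensity_matern {R q r : ℝ} (hR : 0 < R) (hq : 0 < q) (hr : 0 < r)
    (hne : r ≠ |R - q|) :
    ENNReal.ofReal r * ∫⁻ θ in Ioo (-Real.pi) Real.pi,
        ENNReal.ofReal ((matern R).radialDensity (cosineDist r q θ)) =
      ENNReal.ofReal ((matern R).distDensity r q) := by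
  have hset : cosineDist r q ⁻¹' Iic R =
      {θ | (r ^ 2 + q ^ 2 - R ^ 2) / (2 * r * q) ≤ Real.cos θ} := by
    ext θ
    rw [mem_preimage, mem_Iic, mem_ofPred_eq, cosineDist, Real.sqrt_le_left hR.le,
      div_le_iff₀ (by positivity)]
    constructor <;> intro h <;> linarith
  have hmeas : MeasurableSet {θ | (r ^ 2 + q ^ 2 - R ^ 2) / (2 * r * q) ≤ Real.cos θ} :=
    measurableSet_le measurable_const Real.measurable_cos
  have hindicator (θ : ℝ) : ENNReal.ofReal ((matern R).radialDensity (cosineDist r q θ)) =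
      {θ | (r ^ 2 + q ^ 2 - R ^ 2) / (2 * r * q) ≤ Real.cos θ}.indicator
        (fun _ => ENNReal.ofReal (1 / (Real.pi * R ^ 2))) θ := by
    rw [ofReal_radialDensity_matern, ← hset]
    rfl
  simp_rw [hindicator]
  rw [lintegral_indicator_const hmeas, Measure.restrict_apply hmeas, volume_inter_setOf_le_cos,
    ← ENNReal.ofReal_mul (by positivity), ← ENNReal.ofReal_mul hr.le,
    distDensity_matern hR hq hr hne]
  congr 1
  ring

lemma ae_lintegral_radialDensity (c : ClusterShape) (hc : 0 < c.scale) {q : ℝ} (hq : 0 < q) :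
    ∀ᵐ r : ℝ ∂volume.restrict (Ioi 0), ENNReal.ofReal r * ∫⁻ θ in Ioo (-Real.pi) Real.pi,
        ENNReal.ofReal (c.radialDensity (cosineDist r q θ)) =
      ENNReal.ofReal (c.distDensity r q) := by
  cases c with
  | thomas σ =>
    filter_upwards [ae_restrict_mem measurableSet_Ioi] with r hr
    exact lintegral_radialDensity_thomas hc hr q
  | matern R =>
    filter_upwards [ae_restrict_mem measurableSet_Ioi,
      ae_restrict_of_ae (Measure.ae_ne volume |R - q|)] with r hr hne
    exact lintegral_radialDensity_matern hc hq hr hne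

lemma lintegral_radialDensity_norm_thomas {σ : ℝ} (hσ : 0 < σ) :
    ∫⁻ y : Plane, ENNReal.ofReal ((thomas σ).radialDensity ‖y‖) = 1 := by
  have hgauss := GaussianFourier.integral_rexp_neg_mul_sq_norm (V := Plane)
    (b := 1 / (2 * σ ^ 2)) (by positivity)
  have hint : Integrable fun y : Plane => Real.exp (-(1 / (2 * σ ^ 2)) * ‖y‖ ^ 2) :=
    Integrable.of_integral_ne_zero (by rw [hgauss]; positivity)
  have hexpand (y : Plane) : (thomas σ).radialDensity ‖y‖ =
      1 / (2 * Real.pi * σ ^ 2) * Real.exp (-(1 / (2 * σ ^ 2)) * ‖y‖ ^ 2) := by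
    rw [radialDensity, neg_mul, div_mul_eq_mul_div (1 : ℝ) (2 * σ ^ 2), one_mul]
  rw [← ofReal_integral_eq_lintegral_ofReal (by simpa only [hexpand] using hint.const_mul _)
    (.of_forall fun y => radialDensity_nonneg _ _)]
  simp_rw [hexpand]
  rw [integral_const_mul, hgauss, finrank_euclideanSpace_fin, Nat.cast_ofNat,
    div_self two_ne_zero, Real.rpow_one, ← ENNReal.ofReal_one]
  congr 1
  field_simp

lemma lintegral_radialDensity_norm_matern {R : ℝ} (hR : 0 < R) :
    ∫⁻ y : Plane, ENNReal.ofReal ((matern R).radialDensity ‖y‖) = 1 := by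
  have hnorm : (‖·‖) ⁻¹' Iic R = Metric.closedBall (0 : Plane) R := by
    ext y
    rw [mem_preimage, mem_Iic, mem_closedBall_zero_iff]
  have hball (y : Plane) : ENNReal.ofReal ((matern R).radialDensity ‖y‖) =
      (Metric.closedBall (0 : Plane) R).indicator
        (fun _ => ENNReal.ofReal (1 / (Real.pi * R ^ 2))) y := by
    rw [ofReal_radialDensity_matern, ← hnorm]
    rfl
  simp_rw [hball]
  rw [lintegral_indicator_const Metric.isClosed_closedBall.measurableSet,
    EuclideanSpace.volume_closedBall_fin_two, ← ENNReal.ofReal_pow hR.le,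
    ← ENNReal.ofReal_mul (by positivity), ← ENNReal.ofReal_mul (by positivity),
    ← ENNReal.ofReal_one]
  congr 1
  field_simp

lemma lintegral_radialDensity_norm (c : ClusterShape) (hc : 0 < c.scale) :
    ∫⁻ y : Plane, ENNReal.ofReal (c.radialDensity ‖y‖) = 1 := by
  cases c with
  | thomas σ => exact lintegral_radialDensity_norm_thomas hc
  | matern R => exact lintegral_radialDensity_norm_matern hc

lemma integrable_radialDensity_norm (c : ClusterShape) (hc : 0 < c.scale) :
    Integrable fun y : Plane => c.radialDensity ‖y‖ := by
  refine ⟨(c.measurable_radialDensity.comp measurable_norm).aestronglyMeasurable, ?_⟩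
  rw [hasFiniteIntegral_iff_ofReal (.of_forall fun y => c.radialDensity_nonneg _),
    c.lintegral_radialDensity_norm hc]
  exact ENNReal.one_lt_top

lemma isProbabilityMeasure_offsetLaw (c : ClusterShape) (hc : 0 < c.scale) :
    IsProbabilityMeasure c.offsetLaw := by
  constructor
  rw [offsetLaw, withDensity_apply _ MeasurableSet.univ, setLIntegral_univ]
  simpa only [density_eq_radialDensity, sub_zero] using c.lintegral_radialDensity_norm hc

lemma lintegral_norm_add_offsetLaw (c : ClusterShape) {h : ℝ → ℝ≥0∞} (hh : Measurable h)
    (x : Plane) :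
    ∫⁻ y, h ‖x + y‖ ∂c.offsetLaw =
      ∫⁻ u, h ‖u‖ * ENNReal.ofReal (c.radialDensity ‖u - x‖) := by
  simp_rw [offsetLaw, density_eq_radialDensity, sub_zero]
  rw [lintegral_withDensity_eq_lintegral_mul _ (by fun_prop) (by fun_prop),
    ← lintegral_add_left_eq_self (fun u => h ‖u‖ * ENNReal.ofReal (c.radialDensity ‖u - x‖)) x]
  simp only [Pi.mul_apply, add_sub_cancel_left, mul_comm]

lemma lintegral_norm_add_offsetLaw_eq_distDensity (c : ClusterShape) (hc : 0 < c.scale)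
    {h : ℝ → ℝ≥0∞} (hh : Measurable h) {x : Plane} (hx : x ≠ 0) :
    ∫⁻ y, h ‖x + y‖ ∂c.offsetLaw =
      ∫⁻ g in Ioi (0 : ℝ), h g * ENNReal.ofReal (c.distDensity g ‖x‖) := by
  rw [c.lintegral_norm_add_offsetLaw hh,
    lintegral_norm_norm_sub (F := fun r t => h r * ENNReal.ofReal (c.radialDensity t))
      (by fun_prop)]
  refine lintegral_congr_ae ?_
  filter_upwards [c.ae_lintegral_radialDensity hc (norm_pos_iff.2 hx)] with r hr
  rw [← hr, lintegral_const_mul _ (by fun_prop), mul_left_comm]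

end ClusterShape

/-! ### The interference from the clusters -/

lemma continuous_integral_mul_sub {G : Type*} [AddCommGroup G] [TopologicalSpace G]
    [IsTopologicalAddGroup G] [LocallyCompactSpace G] [SecondCountableTopology G]
    [MeasurableSpace G] [BorelSpace G] {μ : Measure G} [μ.IsAddHaarMeasure]
    {h f : G → ℝ} {C : ℝ} (hm : AEStronglyMeasurable h μ) (hC : ∀ t, |h t| ≤ C)
    (hf : Integrable f μ) : Continuous fun x => ∫ t, h t * f (x - t) ∂μ := by
  have hC0 : 0 ≤ C := (abs_nonneg _).trans (hC 0)
  have hint {g : G → ℝ} (hg : Integrable g μ) (x : G) :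
      Integrable (fun t => h t * g (x - t)) μ :=
    (hg.comp_sub_left x).bdd_mul hm (.of_forall hC)
  refine continuous_of_uniform_approx_of_continuous fun u hu => ?_
  obtain ⟨ε, hε, hεu⟩ := Metric.mem_uniformity_dist.1 hu
  obtain ⟨g, hgsupp, hfg, hgcont, hg⟩ :=
    hf.exists_hasCompactSupport_integral_sub_le (ε := ε / (C + 1)) (by positivity)
  refine ⟨fun x => ∫ t, h t * g (x - t) ∂μ, ?_, fun x => hεu ?_⟩
  · have hloc : LocallyIntegrable h μ :=
      (locallyIntegrable_const C).mono hm (.of_forall fun t => (hC t).trans (le_abs_self C))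
    exact hgsupp.continuous_convolution_right (ContinuousLinearMap.mul ℝ ℝ) hloc hgcont
  · calc dist (∫ t, h t * f (x - t) ∂μ) (∫ t, h t * g (x - t) ∂μ)
        = ‖∫ t, h t * (f (x - t) - g (x - t)) ∂μ‖ := by
          simp_rw [mul_sub]
          rw [integral_sub (hint hf x) (hint hg x), dist_eq_norm]
      _ ≤ ∫ t, C * ‖f (x - t) - g (x - t)‖ ∂μ := by
          refine norm_integral_le_of_norm_le
            (((hf.comp_sub_left x).sub (hg.comp_sub_left x)).norm.const_mul C)
            (.of_forall fun t => ?_)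
          rw [norm_mul]
          exact mul_le_mul_of_nonneg_right (hC t) (norm_nonneg _)
      _ = C * ∫ t, ‖f t - g t‖ ∂μ := by
          rw [integral_const_mul, integral_sub_left_eq_self (fun t => ‖f t - g t‖) μ x]
      _ ≤ C * (ε / (C + 1)) := mul_le_mul_of_nonneg_left hfg hC0
      _ < ε := by
          rw [mul_div_assoc', div_lt_iff₀ (by positivity)]
          nlinarith

namespace UplinkParams

variable (p : UplinkParams)

/-- The Laplace transform at `s` of the channel gain of a user of the cluster centred at `x`. -/
noncomputable def userLaplace (s : ℝ) (x : Plane) : ℝ :=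
  ∫ y, p.linkLaplace s ‖x + y‖ ∂p.shape.offsetLaw

/-- The channel gain of a user of the cluster centred at `x`, as a function of the variables
attached to the user, which are listed as in `userLaw`. -/
noncomputable def userGain (x : Plane) (m : Plane × ℝ × ℝ × ℝ × ℝ) : ℝ :=
  p.linkGain ‖x + m.1‖ m.2

@[fun_prop]
lemma measurable_userGain : Measurable (Function.uncurry p.userGain) :=
  p.measurable_linkGain.comp (f := fun a : Plane × Plane × ℝ × ℝ × ℝ × ℝ =>
    (‖a.1 + a.2.1‖, a.2.2)) (by fun_prop)

lemma userLaw_eq_prod : p.userLaw = p.shape.offsetLaw.prod p.channelLaw := rfl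

namespace Admissible

variable {p} (hp : p.Admissible)
include hp

lemma rootβ_pos : 0 < p.rootβ := Real.sqrt_pos.2 (mul_pos hp.βa_pos hp.βb_pos)

lemma mem_Ico_div_rootβ_iff (n : ℕ) (g : ℝ) :
    g ∈ Ico ((n : ℝ) / p.rootβ) (((n : ℝ) + 1) / p.rootβ) ↔ 0 ≤ g ∧ p.γ g = n := by
  have hβ := hp.rootβ_pos
  rw [mem_Ico, div_le_iff₀ hβ, lt_div_iff₀ hβ, γ]
  constructor
  · intro hg
    have h0 : 0 ≤ g * p.rootβ := (Nat.cast_nonneg n).trans hg.1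
    exact ⟨nonneg_of_mul_nonneg_left h0 hβ, (Nat.floor_eq_iff h0).2 hg⟩
  · rintro ⟨h0, hγ⟩
    exact (Nat.floor_eq_iff (mul_nonneg h0 hβ.le)).1 hγ

lemma Oe_eq_setIntegral {s q : ℝ}
    (hint : IntegrableOn (fun g => p.linkLaplace s g * p.shape.distDensity g q) (Ioi 0)) :
    p.Oe s q = ∫ g in Ioi (0 : ℝ), p.linkLaplace s g * p.shape.distDensity g q := by
  have hβ := hp.rootβ_pos
  have hunion : ⋃ n : ℕ, Ico ((n : ℝ) / p.rootβ) (((n : ℝ) + 1) / p.rootβ) = Ici 0 := by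
    ext g
    simp only [mem_iUnion, hp.mem_Ico_div_rootβ_iff, mem_Ici, exists_and_left, exists_eq',
      and_true]
  have hdisjoint : Pairwise fun m n : ℕ => Disjoint
      (Ico ((m : ℝ) / p.rootβ) (((m : ℝ) + 1) / p.rootβ))
      (Ico ((n : ℝ) / p.rootβ) (((n : ℝ) + 1) / p.rootβ)) := fun m n hmn =>
    disjoint_left.2 fun g hm hn => hmn <|
      ((hp.mem_Ico_div_rootβ_iff m g).1 hm).2.symm.trans ((hp.mem_Ico_div_rootβ_iff n g).1 hn).2
  rw [← integral_Ici_eq_integral_Ioi, ← hunion, integral_iUnion (fun n => measurableSet_Ico)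
    hdisjoint (by rwa [hunion, integrableOn_Ici_iff_integrableOn_Ioi]), Oe]
  refine tsum_congr fun n => ?_
  rw [intervalIntegral.integral_of_le (by gcongr; linarith), ← integral_Ico_eq_integral_Ioc]
  refine setIntegral_congr_fun measurableSet_Ico fun g hg => ?_
  simp only [linkLaplace, ((hp.mem_Ico_div_rootβ_iff n g).1 hg).2]

variable {s : ℝ} (hs : 0 ≤ s)
include hs

lemma integrable_linkLaplace_norm_add (x : Plane) :
    Integrable (fun y => p.linkLaplace s ‖x + y‖) p.shape.offsetLaw := by
  have := p.shape.isProbabilityMeasure_offsetLaw hp.scale_pos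
  refine .of_bound (Measurable.aestronglyMeasurable (by fun_prop)) 1 (.of_forall fun y => ?_)
  rw [Real.norm_eq_abs, abs_of_nonneg (hp.linkLaplace_nonneg hs _)]
  exact hp.linkLaplace_le_one hs _

lemma ofReal_userLaplace (x : Plane) : ENNReal.ofReal (p.userLaplace s x) =
    ∫⁻ y, ENNReal.ofReal (p.linkLaplace s ‖x + y‖) ∂p.shape.offsetLaw :=
  ofReal_integral_eq_lintegral_ofReal (hp.integrable_linkLaplace_norm_add hs x)
    (.of_forall fun _ => hp.linkLaplace_nonneg hs _)

lemma lintegral_eexpNeg_userGain (x : Plane) :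
    ∫⁻ m, eexpNeg (ENNReal.ofReal s * ENNReal.ofReal (p.userGain x m)) ∂p.userLaw =
      ENNReal.ofReal (p.userLaplace s x) := by
  have := p.shape.isProbabilityMeasure_offsetLaw hp.scale_pos
  have := hp.isProbabilityMeasure_channelLaw
  have hgain : Measurable (p.userGain x) := p.measurable_userGain.comp measurable_prodMk_left
  rw [hp.ofReal_userLaplace hs, p.userLaw_eq_prod]
  refine (lintegral_prod _ (measurable_eexpNeg.comp
    (hgain.ennreal_ofReal.const_mul _)).aemeasurable).trans (lintegral_congr fun y => ?_)
  exact hp.lintegral_eexpNeg_linkGain hs ‖x + y‖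

lemma userLaplace_le_one (x : Plane) : p.userLaplace s x ≤ 1 := by
  have := p.shape.isProbabilityMeasure_offsetLaw hp.scale_pos
  refine (integral_mono (hp.integrable_linkLaplace_norm_add hs x) (integrable_const 1)
    fun y => hp.linkLaplace_le_one hs _).trans_eq ?_
  rw [integral_const, probReal_univ, one_smul]

lemma userLaplace_pos (x : Plane) : 0 < p.userLaplace s x := by
  have := p.shape.isProbabilityMeasure_offsetLaw hp.scale_pos
  rw [userLaplace, integral_pos_iff_support_of_nonneg (fun y => hp.linkLaplace_nonneg hs _)
    (hp.integrable_linkLaplace_norm_add hs x)]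
  have hsupport : Function.support (fun y => p.linkLaplace s ‖x + y‖) = univ :=
    eq_univ_of_forall fun y => (hp.linkLaplace_pos hs _).ne'
  simp [hsupport]

lemma userLaplace_eq_integral_mul_sub (x : Plane) : p.userLaplace s x =
    ∫ u : Plane, p.linkLaplace s ‖u‖ * p.shape.radialDensity ‖x - u‖ := by
  rw [integral_eq_lintegral_of_nonneg_ae
    (.of_forall fun u => mul_nonneg (hp.linkLaplace_nonneg hs _) (p.shape.radialDensity_nonneg _))
    (Measurable.aestronglyMeasurable (by fun_prop)),
    ← ENNReal.toReal_ofReal (hp.userLaplace_pos hs x).le, hp.ofReal_userLaplace hs,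
    p.shape.lintegral_norm_add_offsetLaw (h := fun r => ENNReal.ofReal (p.linkLaplace s r))
      (by fun_prop)]
  simp_rw [ENNReal.ofReal_mul (hp.linkLaplace_nonneg hs _), norm_sub_rev]

lemma continuous_userLaplace : Continuous (p.userLaplace s) := by
  rw [funext (hp.userLaplace_eq_integral_mul_sub hs)]
  refine continuous_integral_mul_sub (h := fun u => p.linkLaplace s ‖u‖)
    (f := fun y => p.shape.radialDensity ‖y‖) (C := 1)
    (Measurable.aestronglyMeasurable (by fun_prop)) (fun u => ?_)
    (p.shape.integrable_radialDensity_norm hp.scale_pos)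
  rw [abs_of_nonneg (hp.linkLaplace_nonneg hs _)]
  exact hp.linkLaplace_le_one hs _

lemma userLaplace_eq_Oe {x : Plane} (hx : x ≠ 0) : p.userLaplace s x = p.Oe s ‖x‖ := by
  have hnonneg : 0 ≤ᵐ[volume.restrict (Ioi (0 : ℝ))]
      fun g => p.linkLaplace s g * p.shape.distDensity g ‖x‖ := by
    filter_upwards [ae_restrict_mem measurableSet_Ioi] with g hg
    exact mul_nonneg (hp.linkLaplace_nonneg hs g) (p.shape.distDensity_nonneg (le_of_lt hg) _)
  have hmeas : AEStronglyMeasurable (fun g => p.linkLaplace s g * p.shape.distDensity g ‖x‖)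
      (volume.restrict (Ioi 0)) := Measurable.aestronglyMeasurable (by fun_prop)
  have hlintegral : ENNReal.ofReal (p.userLaplace s x) = ∫⁻ g in Ioi (0 : ℝ),
      ENNReal.ofReal (p.linkLaplace s g * p.shape.distDensity g ‖x‖) := by
    rw [hp.ofReal_userLaplace hs, p.shape.lintegral_norm_add_offsetLaw_eq_distDensity hp.scale_pos
      (h := fun r => ENNReal.ofReal (p.linkLaplace s r)) (by fun_prop) hx]
    simp_rw [ENNReal.ofReal_mul (hp.linkLaplace_nonneg hs _)]
  rw [hp.Oe_eq_setIntegral, integral_eq_lintegral_of_nonneg_ae hnonneg hmeas, ← hlintegral,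
    ENNReal.toReal_ofReal (hp.userLaplace_pos hs x).le]
  refine ⟨hmeas, ?_⟩
  rw [hasFiniteIntegral_iff_ofReal hnonneg, ← hlintegral]
  exact ENNReal.ofReal_lt_top

end Admissible

end UplinkParams

lemma tsum_ne_zero_eq_tsum_succ (f : ℕ → ℝ≥0∞) :
    ∑' n : {n : ℕ // n ≠ 0}, f n = ∑' n, f (n + 1) := by
  have hsubtype : ∑' n : {n : ℕ // n ≠ 0}, f n = ∑' n, {n : ℕ | n ≠ 0}.indicator f n :=
    tsum_subtype {n : ℕ | n ≠ 0} f
  rw [hsubtype, tsum_eq_zero_add' ENNReal.summable]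
  simp

namespace UplinkNetwork

variable {p : UplinkParams} {Ω₀ Ω : Type*} [MeasurableSpace Ω₀] [MeasurableSpace Ω]
  {Φ : ℕ → Ω₀ → Plane} {P₀ : Measure Ω₀} {sizeLaw : Measure ℕ} {P : Measure Ω}
  (N : UplinkNetwork p Φ P₀ sizeLaw P)

/-- All variables attached to the user `i.2` of the cluster `i.1`, listed as in `userLaw`. -/
def mark (i : ℕ × ℕ) (ω : Ω) : Plane × ℝ × ℝ × ℝ × ℝ :=
  (N.offset i.1 i.2 ω, N.block i.1 i.2 ω, N.fadeLos i.1 i.2 ω, N.fadeNlos i.1 i.2 ω,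
    N.gain i.1 i.2 ω)

lemma measurable_mark (i : ℕ × ℕ) : Measurable (N.mark i) :=
  (N.measurable_offset _ _).prodMk ((N.measurable_block _ _).prodMk
    ((N.measurable_fadeLos _ _).prodMk ((N.measurable_fadeNlos _ _).prodMk
      (N.measurable_gain _ _))))

lemma channelGain_eq_userGain (n k : ℕ) (ω : Ω) :
    N.channelGain n k ω = p.userGain (N.parent n ω) (N.mark (n, k) ω) := rfl

/-- The interference from the cluster of the `n`-th UAV. -/
noncomputable def clusterInterference (n : ℕ) (ω : Ω) : ℝ≥0∞ :=
  ∑ k ∈ Finset.range (N.size n ω), ENNReal.ofReal (N.channelGain n k ω)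

lemma measurable_clusterInterference (n : ℕ) : Measurable (N.clusterInterference n) := by
  have hgain (k : ℕ) : Measurable fun ω => ENNReal.ofReal (N.channelGain n k ω) :=
    (p.measurable_userGain.comp
      ((N.palm.measurable n).prodMk (N.measurable_mark (n, k)))).ennreal_ofReal
  have hsum : Measurable fun a : ℕ × Ω =>
      ∑ k ∈ Finset.range a.1, ENNReal.ofReal (N.channelGain n k a.2) :=
    measurable_from_prod_countable_right fun m =>
      Finset.measurable_sum (Finset.range m) fun k _ => hgain k
  exact hsum.comp ((N.measurable_size n).prodMk measurable_id)

lemma interInterference_eq_tsum (ω : Ω) :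
    N.interInterference ω = ∑' n, N.clusterInterference (n + 1) ω :=
  tsum_ne_zero_eq_tsum_succ fun n => N.clusterInterference n ω

lemma laplaceInter_eq_toReal (s : ℝ) : N.laplaceInter s =
    (∫⁻ ω, eexpNeg (∑' n, ENNReal.ofReal s * N.clusterInterference (n + 1) ω) ∂P).toReal := by
  simp_rw [laplaceInter, N.interInterference_eq_tsum, ← ENNReal.tsum_mul_left, ← toReal_eexpNeg]
  refine integral_toReal (Measurable.aemeasurable ?_)
    (.of_forall fun ω => (eexpNeg_ne_top _).lt_top)
  exact measurable_eexpNeg.comp (Measurable.tsum fun n =>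
    (N.measurable_clusterInterference (n + 1)).const_mul _)

variable [IsProbabilityMeasure P]

lemma lintegral_eexpNeg_sum_clusterInterference (s : ℝ) (T : Finset ℕ) :
    ∫⁻ ω, eexpNeg (∑ n ∈ T, ENNReal.ofReal s * N.clusterInterference n ω) ∂P =
      ∫⁻ ω, ∏ n ∈ T, ∫⁻ k, (∫⁻ m, eexpNeg (ENNReal.ofReal s *
        ENNReal.ofReal (p.userGain (N.parent n ω) m)) ∂p.userLaw) ^ k ∂sizeLaw ∂P := by
  simp_rw [clusterInterference, Finset.mul_sum, eexpNeg_sum, channelGain_eq_userGain]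
  exact lintegral_prod_clusters N.palm.measurable N.measurable_size N.measurable_mark N.size_law
    (fun i => N.user_law i.1 i.2) N.size_indep N.user_indep N.size_user_indep N.parent_indep
    (ξ := fun x m => eexpNeg (ENNReal.ofReal s * ENNReal.ofReal (p.userGain x m)))
    (measurable_eexpNeg.comp (p.measurable_userGain.ennreal_ofReal.const_mul _)) T

lemma laplaceInter_eq_laplaceFunctional {s : ℝ} {w : Plane → ℝ≥0∞} (hw : Measurable w)
    (hws : ∀ x, ∫⁻ k, (∫⁻ m, eexpNeg (ENNReal.ofReal s * ENNReal.ofReal (p.userGain x m))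
      ∂p.userLaw) ^ k ∂sizeLaw = eexpNeg (w x)) :
    N.laplaceInter s = (laplaceFunctional (fun n => N.parent (n + 1)) P w).toReal := by
  have hpartial (m : ℕ) : ∫⁻ ω, eexpNeg (∑ n ∈ Finset.range m,
        ENNReal.ofReal s * N.clusterInterference (n + 1) ω) ∂P =
      ∫⁻ ω, eexpNeg (∑ n ∈ Finset.range m, w (N.parent (n + 1) ω)) ∂P := by
    simpa only [hws, Finset.sum_map, Finset.prod_map, addRightEmbedding_apply, ← eexpNeg_sum]
      using N.lintegral_eexpNeg_sum_clusterInterference s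
        ((Finset.range m).map (addRightEmbedding 1))
  have hinterference := tendsto_lintegral_eexpNeg_sum_range (P := P) fun n =>
    (N.measurable_clusterInterference (n + 1)).const_mul (ENNReal.ofReal s)
  simp_rw [hpartial] at hinterference
  simp_rw [laplaceFunctional, lintegral_config hw, N.laplaceInter_eq_toReal]
  exact congrArg ENNReal.toReal (tendsto_nhds_unique hinterference
    (tendsto_lintegral_eexpNeg_sum_range fun n => hw.comp (N.palm.measurable (n + 1))))

end UplinkNetwork

namespace UplinkParams

variable (p : UplinkParams)

/-- Minus the logarithm of the Laplace transform at `s` of the interference from a cluster centred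
at `x` with size distributed according to `sizeLaw`. -/
noncomputable def clusterExponent (sizeLaw : Measure ℕ) (s : ℝ) (x : Plane) : ℝ≥0 :=
  (-Real.log (pgf sizeLaw (p.userLaplace s x))).toNNReal

namespace Admissible

variable {p} (hp : p.Admissible) {s : ℝ} (hs : 0 ≤ s) (sizeLaw : Measure ℕ)
  [IsProbabilityMeasure sizeLaw]
include hp hs

lemma eexpNeg_clusterExponent (x : Plane) :
    eexpNeg (p.clusterExponent sizeLaw s x) =
      ENNReal.ofReal (pgf sizeLaw (p.userLaplace s x)) := by
  have hpos := hp.userLaplace_pos hs x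
  have hle := hp.userLaplace_le_one hs x
  have hpgf := pgf_pos sizeLaw ⟨hpos, hle⟩
  have hlog := Real.log_nonpos hpgf.le (pgf_le_one sizeLaw ⟨hpos.le, hle⟩)
  rw [clusterExponent, ← ENNReal.ofReal, eexpNeg_ofReal (neg_nonneg.2 hlog), neg_neg,
    Real.exp_log hpgf]

lemma continuous_pgf_userLaplace : Continuous fun x => pgf sizeLaw (p.userLaplace s x) :=
  (continuousOn_pgf sizeLaw).comp_continuous (hp.continuous_userLaplace hs) fun x =>
    ⟨(hp.userLaplace_pos hs x).le, hp.userLaplace_le_one hs x⟩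

lemma continuous_clusterExponent : Continuous (p.clusterExponent sizeLaw s) :=
  continuous_real_toNNReal.comp ((hp.continuous_pgf_userLaplace hs sizeLaw).log fun x =>
    (pgf_pos sizeLaw ⟨hp.userLaplace_pos hs x, hp.userLaplace_le_one hs x⟩).ne').neg

lemma lintegral_pow_userGain (x : Plane) :
    ∫⁻ k, (∫⁻ m, eexpNeg (ENNReal.ofReal s * ENNReal.ofReal (p.userGain x m)) ∂p.userLaw) ^ k
      ∂sizeLaw = eexpNeg (p.clusterExponent sizeLaw s x) := by
  rw [hp.eexpNeg_clusterExponent hs, ofReal_pgf sizeLaw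
    ⟨(hp.userLaplace_pos hs x).le, hp.userLaplace_le_one hs x⟩]
  simp_rw [hp.lintegral_eexpNeg_userGain hs]

lemma lintegral_one_sub_eexpNeg_clusterExponent :
    ∫⁻ y, (1 - eexpNeg (p.clusterExponent sizeLaw s y)) = ENNReal.ofReal (2 * Real.pi) *
      ∫⁻ q in Ioi (0 : ℝ), ENNReal.ofReal ((1 - pgf sizeLaw (p.Oe s q)) * q) := by
  have hradial {q : ℝ} (hq : 0 < q) :
      p.userLaplace s (EuclideanSpace.single 0 q) = p.Oe s q := by
    have hne : (EuclideanSpace.single 0 q : Plane) ≠ 0 := by simpa using hq.ne'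
    rw [hp.userLaplace_eq_Oe hs hne, PiLp.norm_single, Real.norm_of_nonneg hq.le]
  have hcont : Continuous fun q : ℝ =>
      pgf sizeLaw (p.userLaplace s (EuclideanSpace.single 0 q)) :=
    (hp.continuous_pgf_userLaplace hs sizeLaw).comp ((PiLp.continuous_toLp 2 _).comp
      (continuous_single (A := fun _ : Fin 2 => ℝ) 0))
  calc ∫⁻ y, (1 - eexpNeg (p.clusterExponent sizeLaw s y))
      = ∫⁻ y : Plane,
          ENNReal.ofReal (1 - pgf sizeLaw (p.userLaplace s (EuclideanSpace.single 0 ‖y‖))) := by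
        refine lintegral_congr_ae ?_
        filter_upwards [Measure.ae_ne volume (0 : Plane)] with y hy
        rw [hp.eexpNeg_clusterExponent hs, hradial (norm_pos_iff.2 hy),
          ← hp.userLaplace_eq_Oe hs hy, ENNReal.ofReal_sub, ENNReal.ofReal_one]
        exact (pgf_pos sizeLaw ⟨hp.userLaplace_pos hs y, hp.userLaplace_le_one hs y⟩).le
    _ = ENNReal.ofReal (2 * Real.pi) * ∫⁻ q in Ioi (0 : ℝ), ENNReal.ofReal q *
          ENNReal.ofReal (1 - pgf sizeLaw (p.userLaplace s (EuclideanSpace.single 0 q))) :=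
        lintegral_plane_norm (hcont.measurable.const_sub 1).ennreal_ofReal
    _ = ENNReal.ofReal (2 * Real.pi) *
          ∫⁻ q in Ioi (0 : ℝ), ENNReal.ofReal ((1 - pgf sizeLaw (p.Oe s q)) * q) := by
        congr 1
        refine setLIntegral_congr_fun measurableSet_Ioi fun q hq => ?_
        rw [hradial hq, ← ENNReal.ofReal_mul (le_of_lt hq), mul_comm]

end Admissible

end UplinkParams

theorem lemma3_general {Ω₀ Ω : Type*} [MeasurableSpace Ω₀] [MeasurableSpace Ω]
    {P₀ : Measure Ω₀} [IsProbabilityMeasure P₀] {P : Measure Ω} [IsProbabilityMeasure P]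
    {p : UplinkParams} (hp : p.Admissible)
    {Φ : ℕ → Ω₀ → Plane} (hΦ : IsHomogeneousPPP p.lam Φ P₀) {sizeLaw : Measure ℕ}
    (N : UplinkNetwork p Φ P₀ sizeLaw P) {s : ℝ} (hs : 0 ≤ s) :
    N.laplaceInter s =
      expNeg (ENNReal.ofReal (2 * Real.pi * p.lam) *
        ∫⁻ q in Ioi (0 : ℝ), ENNReal.ofReal ((1 - pgf sizeLaw (p.Oe s q)) * q)) := by
  have : IsProbabilityMeasure sizeLaw := (N.size_law 0).isProbabilityMeasure_iff.1 inferInstance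
  have hw := hp.continuous_clusterExponent hs sizeLaw
  calc N.laplaceInter s
      = (laplaceFunctional (fun n => N.parent (n + 1)) P
          fun y => p.clusterExponent sizeLaw s y).toReal :=
        N.laplaceInter_eq_laplaceFunctional hw.measurable.coe_nnreal_ennreal
          (hp.lintegral_pow_userGain hs sizeLaw)
    _ = (poissonLaplace p.lam fun y => p.clusterExponent sizeLaw s y).toReal := by
        rw [N.palm.laplaceFunctional_reduced hΦ hp.lam_pos hw]
    _ = _ := by
        rw [poissonLaplace, hp.lintegral_one_sub_eexpNeg_clusterExponent hs, ← mul_assoc,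
          ← ENNReal.ofReal_mul hp.lam_pos.le, mul_comm p.lam, toReal_eexpNeg]

theorem lemma3 {Ω₀ Ω : Type*} [MeasurableSpace Ω₀] [MeasurableSpace Ω]
    (P₀ : Measure Ω₀) [IsProbabilityMeasure P₀] (P : Measure Ω) [IsProbabilityMeasure P]
    (p : UplinkParams) (hp : p.Admissible)
    (Φ : ℕ → Ω₀ → Plane) (hΦ : IsHomogeneousPPP p.lam Φ P₀)
    (Nbar : ℕ) (nbar : ℝ≥0) (s : ℝ) (hs : 0 ≤ s) :
    (∀ N : UplinkNetwork p Φ P₀ (Measure.dirac Nbar) P,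
      N.laplaceInter s =
        expNeg (ENNReal.ofReal (2 * Real.pi * p.lam) *
          ∫⁻ q in Ioi (0 : ℝ), ENNReal.ofReal ((1 - p.Oe s q ^ Nbar) * q))) ∧
    (∀ N : UplinkNetwork p Φ P₀ (poissonMeasure nbar) P,
      N.laplaceInter s =
        expNeg (ENNReal.ofReal (2 * Real.pi * p.lam) *
          ∫⁻ q in Ioi (0 : ℝ),
            ENNReal.ofReal ((1 - Real.exp (-((nbar : ℝ) * (1 - p.Oe s q)))) * q))) := by
  exact ⟨fun N => by simpa only [pgf_dirac] using lemma3_general hp hΦ N hs,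
    fun N => by simpa only [pgf_poissonMeasure] using lemma3_general hp hΦ N hs⟩
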